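/- Let $\nu$ be a non-zero finite Borel measure on $(0,1)$ and let $\Lambda$ be Lebesgue measure. Let $H^1_0(0,1)$ be the space of functions $f:[0,1]\to\mathbb R$ with $f(0)=f(1)=0$ for which there is $\nabla f\in L^2([0,1],\Lambda)$ with $f(x)=f(0)+\int_{[0,x]}\nabla f\,d\Lambda$ for all $x\in[0,1]$. Let $\operatorname{dom}(\mathcal E_\nu)$ be the set of $f\in H^1_0(0,1)$ that are affine linear on every connected component of $[0,1]\setminus\operatorname{supp}\nu$, and $\mathcal E_\nu(f,g)=\int_{(0,1)}\nabla f\,\nabla g\,d\Lambda$. A number $\lambda\in\mathbb R$ is an eigenvalue of $\mathcal E_\nu$ with eigenfunction $f\in\operatorname{dom}(\mathcal E_\nu)\setminus\{0\}$ if $\mathcal E_\nu(f,g)=\lambda\int fg\,d\nu$ for all $g\in\operatorname{dom}(\mathcal E_\nu)$. Let $N_\nu(x)$ be the number of eigenvalues of $\mathcal E_\nu$ not exceeding $x$, counted with multiplicity, and let $$\underline s_\nu=\liminf_{x\to\infty}\frac{\log N_\nu(x)}{\log x}$$ be the lower spectral dimension of $\nu$. For $q\in\mathbb R$ put $$\beta_n^\nu(q)=\frac1{\log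 2^n}\log\sum_{C}\nu(C)^q,\qquad \beta_\nu(q)=\limsup_{n\to\infty}\beta_n^\nu(q)\in[-\infty,\infty],$$ where the sum is over the intervals $C=(k2^{-n},(k+1)2^{-n}]$, $0\le k<2^n$, with $\nu(C)>0$, and let $$\partial\beta_\nu(q)=\{s\in\mathbb R:\ \beta_\nu(t)\ge s(t-q)+\beta_\nu(q)\ \text{for all } t\in\mathbb R\}.$$ **Proposition 1.5.** Let $q\in[0,1]$ be such that $\beta_\nu(q)=\lim_{n\to\infty}\beta_n^\nu(q)$, and suppose that $-\partial\beta_\nu(q)=[a,b]$ with $a\le b$, where $a\in\mathbb R$ and $b\in\mathbb R\cup\{\infty\}$ (for $b=\infty$ read $[a,b]$ as $[a,\infty)$). Then $$\frac{aq+\beta_\nu(q)}{1+b}\le\underline s_\nu ,$$ where the left-hand side is $0$ if $b=\infty$. -/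

import Mathlib

open MeasureTheory Filter Topology
open scoped Pointwise

noncomputable section

namespace KreinFeller

/-- `g` is a weak derivative of `f` on `[0,1]`: `g ∈ L²([0,1])` with respect to Lebesgue measure
and `f x = f 0 + ∫_{[0,x]} g` for all `x ∈ [0,1]`. -/
def HasWeakDeriv (f g : ℝ → ℝ) : Prop :=
  MemLp g 2 (volume.restrict (Set.Icc 0 1)) ∧
    ∀ x ∈ Set.Icc (0 : ℝ) 1, f x = f 0 + ∫ t in Set.Icc 0 x, g t

open Classical in
/-- A representative of the weak derivative of `f` (which is unique up to Lebesgue null sets);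
zero if `f` has no weak derivative. -/
def weakDeriv (f : ℝ → ℝ) : ℝ → ℝ :=
  if h : ∃ g, HasWeakDeriv f g then h.choose else 0

/-- The Sobolev space `H₀¹(0,1)`. Since its elements vanish at `0` and `1`, a function on `[0,1]`
is identified with its extension by zero to the real line. -/
def SobolevH10 : Set (ℝ → ℝ) :=
  {f | (∃ g, HasWeakDeriv f g) ∧ ∀ x ∉ Set.Ioo (0 : ℝ) 1, f x = 0}

/-- Functions which are continuous on `[0,1]` and affine linear on each connected component
of `[0,1] \ supp ν`. -/
def AffineOffSupport (ν : Measure ℝ) : Set (ℝ → ℝ) :=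
  {f | ContinuousOn f (Set.Icc 0 1) ∧
    ∀ x ∈ Set.Icc (0 : ℝ) 1 \ ν.support, ∃ c d : ℝ,
      ∀ y ∈ connectedComponentIn (Set.Icc (0 : ℝ) 1 \ ν.support) x, f y = c * y + d}

/-- The (Dirichlet) domain of the form `ℰ_ν`. -/
def formDomain (ν : Measure ℝ) : Set (ℝ → ℝ) :=
  SobolevH10 ∩ AffineOffSupport ν

/-- The form `ℰ_ν(f, g) = ∫_{(0,1)} ∇f ∇g dΛ`. -/
def energy (f g : ℝ → ℝ) : ℝ :=
  ∫ x in Set.Ioo (0 : ℝ) 1, weakDeriv f x * weakDeriv g x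

/-- `f` is an eigenfunction of `ℰ_ν` with eigenvalue `μ`. -/
def IsEigenfunction (ν : Measure ℝ) (μ : ℝ) (f : ℝ → ℝ) : Prop :=
  f ∈ formDomain ν ∧ f ≠ 0 ∧ ∀ g ∈ formDomain ν, energy f g = μ * ∫ x, f x * g x ∂ν

/-- The eigenvalue counting function `N_ν(x)`: the number of eigenvalues of `ℰ_ν` not exceeding
`x`, counted with multiplicity. As eigenspaces to different eigenvalues are linearly independent,
this is the dimension of the span of all eigenfunctions with eigenvalue at most `x`. -/
def eigenvalueCount (ν : Measure ℝ) (x : ℝ) : ℕ∞ :=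
  Cardinal.toENat
    (Module.rank ℝ (Submodule.span ℝ {f : ℝ → ℝ | ∃ μ ≤ x, IsEigenfunction ν μ f}))

/-- The lower spectral dimension `liminf_{x → ∞} log N_ν(x) / log x`. -/
def lowerSpectralDim (ν : Measure ℝ) : EReal :=
  liminf (fun x : ℝ => ENNReal.log (eigenvalueCount ν x : ENNReal) / (Real.log x : EReal)) atTop

/-- The dyadic interval `(k 2⁻ⁿ, (k+1) 2⁻ⁿ]`. -/
def dyadic (n k : ℕ) : Set ℝ := Set.Ioc ((k : ℝ) / 2 ^ n) (((k : ℝ) + 1) / 2 ^ n)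

open Classical in
/-- `β_n^ν(q) = (1 / log 2ⁿ) log ∑ ν(C)^q`, the sum being over the dyadic subintervals `C` of
`(0,1]` of length `2⁻ⁿ` with `ν(C) > 0`. -/
def lqSpectrumAt (ν : Measure ℝ) (n : ℕ) (q : ℝ) : ℝ :=
  1 / Real.log (2 ^ n) *
    Real.log (∑ k ∈ (Finset.range (2 ^ n)).filter (fun k => 0 < ν (dyadic n k)),
      ν.real (dyadic n k) ^ q)

/-- The `L^q`-spectrum `β_ν(q) = limsup_n β_n^ν(q)`; it may be `+∞` for `q < 0`. -/
def lqSpectrum (ν : Measure ℝ) (q : ℝ) : EReal :=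
  limsup (fun n : ℕ => (lqSpectrumAt ν n q : EReal)) atTop

/-- The subdifferential `∂β_ν(q)`. -/
def lqSubdifferential (ν : Measure ℝ) (q : ℝ) : Set ℝ :=
  {s | ∀ t : ℝ, ((s * (t - q) : ℝ) : EReal) + lqSpectrum ν q ≤ lqSpectrum ν t}

end KreinFeller

end

/-!
The operator on the gradients of `formDomain ν` whose form is `∫ f g dν` is compact and positive,
and the reciprocals of its positive eigenvalues are the eigenvalues of `ℰ_ν`. By the min-max
principle `N_ν(x)` is therefore at least the dimension of any space of trial functions in `H₀¹` on
which the energy is less than `x ∫ f² dν`. On a family of dyadic intervals of length `2⁻ⁿ` and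
mass at least `m` which are two intervals apart, the trapezoids that are `1` on one of them span
such a space as soon as `x m > 2 · 2ⁿ`.

Many heavy intervals exist by a Chernoff bound: for `s < a` or `s > b` the line of slope `-s`
through `(q, β_ν(q))` fails to support `β_ν` at some `t`, so the intervals with `ν(C) ≥ 2^{-ns}`,
respectively `ν(C) ≤ 2^{-ns}`, contribute an exponentially small part of `∑ ν(C)^q ≈ 2^{n β_ν(q)}`.
What remains are at least `2^{n(aq + β_ν(q) - ε)}` intervals of mass at least `2^{-n(b + ε)}`,
whence `N_ν(x) ≥ 2^{n(aq + β_ν(q) - 2ε)}` for `x = 2^{n(1 + b + 2ε)}`.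
-/

noncomputable section

namespace KreinFeller

open Asymptotics
open scoped InnerProductSpace

section Spectral

variable {𝕜 H : Type*} [RCLike 𝕜] [NormedAddCommGroup H] [InnerProductSpace 𝕜 H]

/-- The span of the eigenvectors of `T` with eigenvalue at least `l`. For a compact positive `T` and
`l > 0` this is the range of the spectral projection of `T` for `[l, ∞)`. -/
def topEigenspan (T : H →L[𝕜] H) (l : ℝ) : Submodule 𝕜 H :=
  Submodule.span 𝕜 {u | ∃ r : ℝ, l ≤ r ∧ T u = (r : 𝕜) • u}

theorem map_mem_topEigenspan (T : H →L[𝕜] H) (l : ℝ) :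
    ∀ u ∈ topEigenspan T l, T u ∈ topEigenspan T l := by
  refine Submodule.span_le (p := (topEigenspan T l).comap (T : H →ₗ[𝕜] H)) |>.2 ?_
  rintro u ⟨r, hr, hu⟩
  have hmem : u ∈ topEigenspan T l := Submodule.subset_span ⟨r, hr, hu⟩
  simpa [hu] using Submodule.smul_mem _ (r : 𝕜) hmem

theorem map_mem_topEigenspan_orthogonal {T : H →L[𝕜] H} (hT : T.IsSymmetric) (l : ℝ) :
    ∀ u ∈ (topEigenspan T l)ᗮ, T u ∈ (topEigenspan T l)ᗮ := fun u hu v hv =>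
  (hT v u).symm.trans (hu _ (map_mem_topEigenspan T l v hv))

variable [CompleteSpace H] {T : H →L[𝕜] H} (hpos : T.IsPositive) (hcomp : IsCompactOperator T)
include hpos hcomp

theorem hasEigenvalue_norm (hT : T ≠ 0) :
    Module.End.HasEigenvalue (T : Module.End 𝕜 H) (‖T‖ : 𝕜) := by
  have hnorm : (‖T‖ : 𝕜) ≠ 0 := RCLike.ofReal_ne_zero.2 (norm_ne_zero_iff.2 hT)
  have : Nontrivial H := not_subsingleton_iff_nontrivial.1 fun _ => hT (Subsingleton.elim _ _)
  refine (hcomp.hasEigenvalue_or_mem_resolventSet hnorm).resolve_right fun hres => ?_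
  obtain ⟨ε, hε, hquot⟩ := T.rayleighQuotient_le_of_norm_mem_resolventSet hres
  have hle : ‖T‖ ≤ ‖T‖ - ε := by
    conv_lhs => rw [T.norm_eq_iSup_rayleighQuotient hpos.isSymmetric]
    refine ciSup_le fun u => ?_
    have hnonneg : 0 ≤ T.rayleighQuotient u :=
      div_nonneg (hpos.re_inner_nonneg_left u) (sq_nonneg _)
    exact (abs_of_nonneg hnonneg).trans_le (hquot u)
  linarith

theorem norm_restrict_topEigenspan_orthogonal_le {l : ℝ} (hl : 0 ≤ l) :
    ‖T.restrict (map_mem_topEigenspan_orthogonal hpos.isSymmetric l)‖ ≤ l := by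
  have hinv := map_mem_topEigenspan_orthogonal hpos.isSymmetric l
  set S := T.restrict hinv
  by_contra! hlt
  have hS : S ≠ 0 := norm_ne_zero_iff.1 (hl.trans_lt hlt).ne'
  have hSpos : S.IsPositive :=
    ⟨hpos.isSymmetric.restrict_invariant hinv, fun v => hpos.re_inner_nonneg_left v⟩
  obtain ⟨v, hv⟩ := (hasEigenvalue_norm hSpos (hcomp.restrict' hinv) hS).exists_hasEigenvector
  have hmem : (v : H) ∈ topEigenspan T l :=
    Submodule.subset_span ⟨‖S‖, hlt.le, congrArg Subtype.val hv.apply_eq_smul⟩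
  exact hv.2 (Subtype.ext (inner_self_eq_zero.1 (v.2 _ hmem)))

theorem re_inner_le_of_mem_topEigenspan_orthogonal {l : ℝ} (hl : 0 ≤ l) {u : H}
    (hu : u ∈ (topEigenspan T l)ᗮ) : RCLike.re (inner 𝕜 (T u) u) ≤ l * ‖u‖ ^ 2 := by
  have hTu : ‖T u‖ ≤ l * ‖u‖ :=
    (T.restrict (map_mem_topEigenspan_orthogonal hpos.isSymmetric l)).le_of_opNorm_le
      (norm_restrict_topEigenspan_orthogonal_le hpos hcomp hl) ⟨u, hu⟩
  calc RCLike.re (inner 𝕜 (T u) u) ≤ ‖T u‖ * ‖u‖ := re_inner_le_norm _ _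
    _ ≤ l * ‖u‖ * ‖u‖ := by gcongr
    _ = l * ‖u‖ ^ 2 := by ring

/-- The half of the min-max principle which bounds the number of eigenvalues from below. -/
theorem finrank_le_rank_topEigenspan {l : ℝ} (hl : 0 ≤ l)
    {E : Type*} [AddCommGroup E] [Module 𝕜 E] (L : E →ₗ[𝕜] H)
    (hL : ∀ c ≠ 0, l * ‖L c‖ ^ 2 < RCLike.re (inner 𝕜 (T (L c)) (L c))) :
    (Module.finrank 𝕜 E : ℕ∞) ≤ Cardinal.toENat (Module.rank 𝕜 (topEigenspan T l)) := by
  by_cases hfin : FiniteDimensional 𝕜 (topEigenspan T l)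
  · rw [← Module.finrank_eq_rank, map_natCast, Nat.cast_le]
    let P : E →ₗ[𝕜] topEigenspan T l :=
      ((topEigenspan T l).orthogonalProjectionOnto : H →ₗ[𝕜] topEigenspan T l) ∘ₗ L
    refine LinearMap.finrank_le_finrank_of_injective (f := P)
      ((injective_iff_map_eq_zero P).2 fun c hc => ?_)
    by_contra hc0
    exact (hL c hc0).not_ge (re_inner_le_of_mem_topEigenspan_orthogonal hpos hcomp hl
      (Submodule.orthogonalProjectionOnto_eq_zero_iff.1 hc))
  · rw [Cardinal.toENat_eq_top.2 (not_lt.1 (mt Module.rank_lt_aleph0_iff.1 hfin))]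
    exact le_top

end Spectral

section KernelOperator

theorem integral_mem_of_isClosed {α E : Type*} [MeasurableSpace α] {μ : Measure α}
    [NormedAddCommGroup E] [NormedSpace ℝ E] {S : Submodule ℝ E} (hS : IsClosed (S : Set E))
    {f : α → E} (hf : ∀ᵐ a ∂μ, f a ∈ S) : ∫ a, f a ∂μ ∈ S := by
  by_cases hE : CompleteSpace E
  swap
  · simp [integral, hE]
  by_cases hi : Integrable f μ
  · have : IsClosed (S : Set E) := hS
    rw [← Submodule.Quotient.mk_eq_zero]
    have hq : ∀ᵐ a ∂μ, S.mkQL (f a) = 0 :=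
      hf.mono fun a ha => (Submodule.Quotient.mk_eq_zero S).2 ha
    exact (S.mkQL.integral_comp_comm hi).symm.trans (integral_eq_zero_of_ae hq)
  · rw [integral_undef hi]
    exact S.zero_mem

open InnerProductSpace

variable {α H : Type*} [MeasurableSpace α] [NormedAddCommGroup H] [InnerProductSpace ℝ H]
  {ν : Measure α} {k : α → H}

/-- The integral operator `u ↦ ∫ ⟪k y, u⟫ k y dν(y)`; it is zero by convention if its integrand is
not integrable in the operator norm. -/
def kernelOperator (ν : Measure α) (k : α → H) : H →L[ℝ] H :=
  ∫ y, rankOne ℝ (k y) (k y) ∂ν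

theorem integrable_rankOne (hk : MemLp k 2 ν) : Integrable (fun y => rankOne ℝ (k y) (k y)) ν := by
  have hcont : Continuous fun v : H => rankOne ℝ v v :=
    (rankOne ℝ).continuous.clm_apply continuous_id
  refine (integrable_norm_iff (hcont.comp_aestronglyMeasurable hk.1)).1 ?_
  simp only [norm_rankOne, ← sq]
  exact (memLp_two_iff_integrable_sq_norm hk.1).1 hk

variable [CompleteSpace H]

theorem isCompactOperator_kernelOperator (ν : Measure α) (k : α → H) :
    IsCompactOperator (kernelOperator ν k) := by
  refine integral_mem_of_isClosed (S := compactOperator (RingHom.id ℝ) H H)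
    isClosed_setOfPred_isCompactOperator (Eventually.of_forall fun y => ?_)
  change IsCompactOperator (rankOne ℝ (k y) (k y))
  rw [rankOne_def']
  exact (isCompactOperator_of_locallyCompactSpace_rng
    (ContinuousLinearMap.toSpanSingleton ℝ (k y))).comp_clm _

theorem inner_kernelOperator (hk : MemLp k 2 ν) (u v : H) :
    ⟪kernelOperator ν k u, v⟫_ℝ = ∫ y, ⟪k y, u⟫_ℝ * ⟪k y, v⟫_ℝ ∂ν := by
  have hi := integrable_rankOne hk
  rw [kernelOperator, ContinuousLinearMap.integral_apply hi, real_inner_comm,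
    ← integral_inner (hi.apply_continuousLinearMap u)]
  simp only [rankOne_apply, inner_smul_right, real_inner_comm v]

theorem isPositive_kernelOperator (hk : MemLp k 2 ν) : (kernelOperator ν k).IsPositive := by
  refine (ContinuousLinearMap.isPositive_iff _).2 ⟨fun u v => ?_, fun u => ?_⟩
  · change ⟪kernelOperator ν k u, v⟫_ℝ = ⟪u, kernelOperator ν k v⟫_ℝ
    simp only [real_inner_comm _ u, inner_kernelOperator hk, mul_comm]
  · rw [inner_kernelOperator hk]
    exact integral_nonneg fun y => mul_self_nonneg _

end KernelOperator

section Primitive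

theorem ae_eq_zero_of_forall_setIntegral_Iic_eq_zero {E : Type*} [NormedAddCommGroup E]
    [NormedSpace ℝ E] [CompleteSpace E] {μ : Measure ℝ} {f : ℝ → E} (hf : Integrable f μ)
    (h : ∀ y, ∫ t in Set.Iic y, f t ∂μ = 0) : f =ᵐ[μ] 0 := by
  have huniv : ∫ t, f t ∂μ = 0 := by
    have hlim := (aecover_Iic tendsto_id).integral_tendsto_of_countably_generated hf
    simp only [id, h] at hlim
    exact tendsto_nhds_unique hlim tendsto_const_nhds
  suffices hall : ∀ s, MeasurableSet s → ∫ t in s, f t ∂μ = 0 from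
    hf.ae_eq_zero_of_forall_setIntegral_eq_zero fun s hs _ => hall s hs
  intro s hs
  induction s, hs using MeasurableSpace.induction_on_inter
    (borel_eq_generateFrom_Iic ℝ ▸ BorelSpace.measurable_eq) isPiSystem_Iic with
  | empty => exact setIntegral_empty
  | basic s hs => obtain ⟨y, rfl⟩ := hs; exact h y
  | compl s hs ih => rw [setIntegral_compl hs hf, ih, huniv, sub_zero]
  | iUnion s hd hs ih => simp only [integral_iUnion hs hd hf.integrableOn, ih, tsum_zero]

/-- The Hilbert space `L²([0,1])`, in which the gradients of the functions in `H₀¹(0,1)` live. -/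
abbrev L2Unit : Type := Lp ℝ 2 (volume.restrict (Set.Icc (0 : ℝ) 1))

/-- The indicator function of `[0, y]` in `L²([0,1])`; it represents the functional which sends a
gradient to the value at `y` of its primitive. -/
def evalVec (y : ℝ) : L2Unit :=
  indicatorConstLp 2 (measurableSet_Iic (a := y)) (measure_ne_top _ _) 1

/-- The primitive vanishing at `0` of an element of `L²([0,1])`. Off `[0,1]` it is constant, so a
primitive which vanishes at `1` is extended by zero, as in `SobolevH10`. -/
def primitive : L2Unit →ₗ[ℝ] (ℝ → ℝ) :=
  LinearMap.pi fun y => (innerSL ℝ (evalVec y) : L2Unit →ₗ[ℝ] ℝ)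

theorem primitive_apply (u : L2Unit) (y : ℝ) : primitive u y = ⟪evalVec y, u⟫_ℝ := rfl

theorem primitive_eq_setIntegral_Iic (u : L2Unit) (y : ℝ) :
    primitive u y = ∫ t in Set.Iic y, u t ∂(volume.restrict (Set.Icc (0 : ℝ) 1)) := by
  rw [primitive_apply, evalVec, L2.inner_indicatorConstLp_one]

theorem setIntegral_Iic_restrict_Icc {y : ℝ} (hy : y ≤ 1) (f : ℝ → ℝ) :
    ∫ t in Set.Iic y, f t ∂(volume.restrict (Set.Icc (0 : ℝ) 1)) = ∫ t in Set.Icc 0 y, f t := by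
  rw [Measure.restrict_restrict measurableSet_Iic, ← Set.Ici_inter_Iic, Set.inter_left_comm,
    Set.Iic_inter_Iic, min_eq_left hy, Set.Ici_inter_Iic]

theorem primitive_evalVec (x y : ℝ) :
    primitive (evalVec x) y = (Set.projIcc (0 : ℝ) 1 zero_le_one (min y x) : ℝ) := by
  rw [Set.coe_projIcc, primitive_apply, evalVec, evalVec,
    L2.real_inner_indicatorConstLp_one_indicatorConstLp_one,
    measureReal_restrict_apply (measurableSet_Iic.inter measurableSet_Iic), Set.Iic_inter_Iic,
    ← Set.Ici_inter_Iic, Set.inter_left_comm, Set.Iic_inter_Iic, Set.Ici_inter_Iic,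
    Real.volume_real_Icc, sub_zero, max_comm, min_comm 1]

theorem primitive_evalVec_of_mem {x y : ℝ} (hx : x ∈ Set.Icc (0 : ℝ) 1)
    (hy : y ∈ Set.Icc (0 : ℝ) 1) : primitive (evalVec x) y = min y x := by
  rw [primitive_evalVec, Set.projIcc_of_mem zero_le_one
    (⟨le_min hy.1 hx.1, min_le_of_left_le hy.2⟩ : min y x ∈ Set.Icc (0 : ℝ) 1)]

theorem norm_evalVec_sub_sq (x y : ℝ) : ‖evalVec x - evalVec y‖ ^ 2 =
    |(Set.projIcc (0 : ℝ) 1 zero_le_one x : ℝ) - Set.projIcc (0 : ℝ) 1 zero_le_one y| := by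
  wlog hxy : x ≤ y generalizing x y
  · rw [norm_sub_rev, abs_sub_comm, this y x (le_of_not_ge hxy)]
  have hmono : (Set.projIcc (0 : ℝ) 1 zero_le_one x : ℝ) ≤ Set.projIcc (0 : ℝ) 1 zero_le_one y :=
    Set.monotone_projIcc zero_le_one hxy
  rw [norm_sub_sq_real, ← real_inner_self_eq_norm_sq, ← real_inner_self_eq_norm_sq,
    ← primitive_apply, ← primitive_apply, ← primitive_apply, primitive_evalVec, primitive_evalVec,
    primitive_evalVec, min_self, min_self, min_eq_left hxy, abs_of_nonpos (sub_nonpos.2 hmono)]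
  ring

theorem evalVec_projIcc (y : ℝ) : evalVec (Set.projIcc (0 : ℝ) 1 zero_le_one y) = evalVec y := by
  rw [← sub_eq_zero, ← norm_eq_zero, ← sq_eq_zero_iff, norm_evalVec_sub_sq, Set.projIcc_val,
    sub_self, abs_zero]

theorem norm_evalVec_le (y : ℝ) : ‖evalVec y‖ ≤ 1 := by
  have hsq : ‖evalVec y‖ ^ 2 ≤ 1 := by
    rw [← real_inner_self_eq_norm_sq, ← primitive_apply, primitive_evalVec]
    exact (Set.projIcc (0 : ℝ) 1 zero_le_one _).2.2
  exact (sq_le_one_iff₀ (norm_nonneg _)).1 hsq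

theorem continuous_evalVec : Continuous evalVec := by
  refine continuous_iff_continuousAt.2 fun x => tendsto_iff_norm_sub_tendsto_zero.2 ?_
  have hnorm : (fun y => ‖evalVec y - evalVec x‖) = fun y =>
      √|(Set.projIcc (0 : ℝ) 1 zero_le_one y : ℝ) - Set.projIcc (0 : ℝ) 1 zero_le_one x| :=
    funext fun y => by rw [← norm_evalVec_sub_sq, Real.sqrt_sq (norm_nonneg _)]
  have : Continuous (Set.projIcc (0 : ℝ) 1 zero_le_one) := continuous_projIcc
  rw [hnorm]
  exact Continuous.tendsto' (by fun_prop) x 0 (by simp)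

theorem continuous_primitive (u : L2Unit) : Continuous (primitive u) :=
  continuous_evalVec.inner continuous_const

theorem primitive_zero_right (u : L2Unit) : primitive u 0 = 0 := by
  rw [primitive_eq_setIntegral_Iic, setIntegral_Iic_restrict_Icc zero_le_one, Set.Icc_self,
    Measure.restrict_singleton]
  simp

theorem primitive_projIcc (u : L2Unit) (y : ℝ) :
    primitive u (Set.projIcc (0 : ℝ) 1 zero_le_one y) = primitive u y := by
  rw [primitive_apply, evalVec_projIcc, primitive_apply]

theorem primitive_of_notMem_Ioo {u : L2Unit} (hu : primitive u 1 = 0) {y : ℝ}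
    (hy : y ∉ Set.Ioo (0 : ℝ) 1) : primitive u y = 0 := by
  rw [← primitive_projIcc]
  rcases le_or_gt y 0 with hy0 | hy0
  · rw [Set.projIcc_of_le_left _ hy0, primitive_zero_right]
  · rw [Set.projIcc_of_right_le _ (not_lt.1 fun hy1 => hy ⟨hy0, hy1⟩), hu]

theorem primitive_injective : Function.Injective primitive := by
  refine (injective_iff_map_eq_zero primitive).2 fun u hu => Lp.eq_zero_iff_ae_eq_zero.2 ?_
  refine ae_eq_zero_of_forall_setIntegral_Iic_eq_zero ((Lp.memLp u).integrable one_le_two)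
    fun y => ?_
  rw [← primitive_eq_setIntegral_Iic, hu, Pi.zero_apply]

theorem hasWeakDeriv_primitive (u : L2Unit) : HasWeakDeriv (primitive u) u :=
  ⟨Lp.memLp u, fun x hx => by
    rw [primitive_zero_right, zero_add, primitive_eq_setIntegral_Iic,
      setIntegral_Iic_restrict_Icc hx.2]⟩

theorem HasWeakDeriv.exists_primitive {f g : ℝ → ℝ} (h : HasWeakDeriv f g) (h0 : f 0 = 0) :
    ∃ u : L2Unit, g =ᵐ[volume.restrict (Set.Icc (0 : ℝ) 1)] u ∧
      ∀ y ∈ Set.Icc (0 : ℝ) 1, primitive u y = f y := by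
  have hu := h.1.coeFn_toLp
  refine ⟨h.1.toLp g, hu.symm, fun y hy => ?_⟩
  have hf : f y = ∫ t in Set.Iic y, g t ∂(volume.restrict (Set.Icc (0 : ℝ) 1)) := by
    rw [h.2 y hy, h0, zero_add, setIntegral_Iic_restrict_Icc hy.2]
  rw [hf, primitive_eq_setIntegral_Iic]
  exact setIntegral_congr_ae measurableSet_Iic (hu.mono fun t ht _ => ht)

theorem hasWeakDeriv_weakDeriv {f : ℝ → ℝ} (hf : ∃ g, HasWeakDeriv f g) :
    HasWeakDeriv f (weakDeriv f) := by
  rw [weakDeriv, dif_pos hf]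
  exact hf.choose_spec

theorem weakDeriv_primitive (u : L2Unit) :
    weakDeriv (primitive u) =ᵐ[volume.restrict (Set.Icc (0 : ℝ) 1)] u := by
  obtain ⟨v, hv, hvu⟩ := (hasWeakDeriv_weakDeriv ⟨u, hasWeakDeriv_primitive u⟩).exists_primitive
    (primitive_zero_right u)
  have : v = u := primitive_injective <| funext fun y => by
    rw [← primitive_projIcc v, ← primitive_projIcc u, hvu _ (Subtype.property _)]
  rwa [this] at hv

theorem energy_primitive (u v : L2Unit) : energy (primitive u) (primitive v) = ⟪u, v⟫_ℝ := by
  rw [energy, ← integral_Icc_eq_integral_Ioo, L2.inner_def]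
  refine integral_congr_ae ?_
  filter_upwards [weakDeriv_primitive u, weakDeriv_primitive v] with t hu hv
  rw [hu, hv, mul_comm]
  rfl

theorem mem_sobolevH10_iff {f : ℝ → ℝ} :
    f ∈ SobolevH10 ↔ ∃ u, primitive u 1 = 0 ∧ primitive u = f := by
  constructor
  · rintro ⟨⟨g, hg⟩, hf⟩
    obtain ⟨u, -, hu⟩ := hg.exists_primitive (hf 0 Set.left_notMem_Ioo)
    have hu1 : primitive u 1 = 0 :=
      (hu 1 (Set.right_mem_Icc.2 zero_le_one)).trans (hf 1 Set.right_notMem_Ioo)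
    refine ⟨u, hu1, funext fun y => ?_⟩
    by_cases hy : y ∈ Set.Ioo (0 : ℝ) 1
    · exact hu y (Set.Ioo_subset_Icc_self hy)
    · rw [primitive_of_notMem_Ioo hu1 hy, hf y hy]
  · rintro ⟨u, hu1, rfl⟩
    exact ⟨⟨u, hasWeakDeriv_primitive u⟩, fun y => primitive_of_notMem_Ioo hu1⟩

end Primitive

section GradientSpace

theorem exists_eq_mul_add_iff {S : Set ℝ} {f : ℝ → ℝ} :
    (∃ c d, ∀ y ∈ S, f y = c * y + d) ↔
      ∀ p ∈ S, ∀ r ∈ S, ∀ s ∈ S, (s - r) * f p + (p - s) * f r + (r - p) * f s = 0 := by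
  constructor
  · rintro ⟨c, d, hf⟩ p hp r hr s hs
    rw [hf p hp, hf r hr, hf s hs]
    ring
  intro h
  rcases S.subsingleton_or_nontrivial with hS | ⟨p, hp, r, hr, hpr⟩
  · rcases hS.eq_empty_or_singleton with rfl | ⟨p, rfl⟩
    · simp
    · exact ⟨0, f p, by simp⟩
  · have hne : r - p ≠ 0 := sub_ne_zero.2 hpr.symm
    refine ⟨(f r - f p) / (r - p), f p - (f r - f p) / (r - p) * p, fun y hy => ?_⟩
    field_simp
    linarith [h p hp r hr y hy]

/-- The gradients of the functions in `formDomain ν`. -/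
def gradientSpace (ν : Measure ℝ) : Submodule ℝ L2Unit where
  carrier := {u | primitive u 1 = 0 ∧ ∀ x ∈ Set.Icc (0 : ℝ) 1 \ ν.support, ∃ c d : ℝ,
    ∀ y ∈ connectedComponentIn (Set.Icc (0 : ℝ) 1 \ ν.support) x, primitive u y = c * y + d}
  zero_mem' := ⟨by simp, fun _ _ => ⟨0, 0, by simp⟩⟩
  add_mem' := by
    rintro u v ⟨hu1, hu⟩ ⟨hv1, hv⟩
    refine ⟨by simp [hu1, hv1], fun x hx => ?_⟩
    obtain ⟨c, d, hcd⟩ := hu x hx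
    obtain ⟨c', d', hcd'⟩ := hv x hx
    refine ⟨c + c', d + d', fun y hy => ?_⟩
    rw [map_add, Pi.add_apply, hcd y hy, hcd' y hy]
    ring
  smul_mem' := by
    rintro r u ⟨hu1, hu⟩
    refine ⟨by simp [hu1], fun x hx => ?_⟩
    obtain ⟨c, d, hcd⟩ := hu x hx
    refine ⟨r * c, r * d, fun y hy => ?_⟩
    rw [map_smul, Pi.smul_apply, smul_eq_mul, hcd y hy]
    ring

theorem isClosed_gradientSpace (ν : Measure ℝ) : IsClosed (gradientSpace ν : Set L2Unit) := by
  have hcont : ∀ y, Continuous fun u => primitive u y := fun y =>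
    continuous_const.inner continuous_id
  change IsClosed {u | primitive u 1 = 0 ∧ ∀ x ∈ Set.Icc (0 : ℝ) 1 \ ν.support, ∃ c d : ℝ,
    ∀ y ∈ connectedComponentIn (Set.Icc (0 : ℝ) 1 \ ν.support) x, primitive u y = c * y + d}
  simp only [exists_eq_mul_add_iff, Set.ofPred_and, Set.ofPred_forall]
  refine (isClosed_eq (hcont 1) continuous_const).inter (isClosed_biInter fun x _ =>
    isClosed_biInter fun p _ => isClosed_biInter fun r _ => isClosed_biInter fun s _ => ?_)
  exact isClosed_eq (by fun_prop) continuous_const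

instance (ν : Measure ℝ) : CompleteSpace (gradientSpace ν) :=
  (isClosed_gradientSpace ν).completeSpace_coe

theorem mem_formDomain_iff {ν : Measure ℝ} {f : ℝ → ℝ} :
    f ∈ formDomain ν ↔ ∃ u ∈ gradientSpace ν, primitive u = f := by
  constructor
  · rintro ⟨hf, -, haff⟩
    obtain ⟨u, hu1, rfl⟩ := mem_sobolevH10_iff.1 hf
    exact ⟨u, ⟨hu1, haff⟩, rfl⟩
  · rintro ⟨u, ⟨hu1, haff⟩, rfl⟩
    exact ⟨mem_sobolevH10_iff.2 ⟨u, hu1, rfl⟩, (continuous_primitive u).continuousOn, haff⟩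

/-- The gradient of the Green function `y ↦ min x y - x y` of the Dirichlet Laplacian on `(0,1)`
with pole `x`; it represents the evaluation at `x` on the gradients of functions in `H₀¹(0,1)`. -/
def greenVec (x : ℝ) : L2Unit := evalVec x - x • evalVec 1

theorem primitive_greenVec {x y : ℝ} (hx : x ∈ Set.Icc (0 : ℝ) 1) (hy : y ∈ Set.Icc (0 : ℝ) 1) :
    primitive (greenVec x) y = min y x - x * y := by
  rw [greenVec, map_sub, map_smul, Pi.sub_apply, Pi.smul_apply, smul_eq_mul,
    primitive_evalVec_of_mem hx hy,
    primitive_evalVec_of_mem (Set.right_mem_Icc.2 zero_le_one) hy, min_eq_left hy.2]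

theorem primitive_greenVec_one {x : ℝ} (hx : x ∈ Set.Icc (0 : ℝ) 1) :
    primitive (greenVec x) 1 = 0 := by
  rw [primitive_greenVec hx (Set.right_mem_Icc.2 zero_le_one), min_eq_right hx.2, mul_one, sub_self]

theorem greenVec_mem_gradientSpace {ν : Measure ℝ} {x : ℝ} (hx : x ∈ Set.Icc (0 : ℝ) 1)
    (hxν : x ∈ ν.support) : greenVec x ∈ gradientSpace ν := by
  refine ⟨primitive_greenVec_one hx, fun z _ => ?_⟩
  set A := connectedComponentIn (Set.Icc (0 : ℝ) 1 \ ν.support) z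
  have hsub : A ⊆ Set.Icc (0 : ℝ) 1 \ ν.support := connectedComponentIn_subset _ _
  have hside : (∀ y ∈ A, y ≤ x) ∨ ∀ y ∈ A, x ≤ y := by
    by_contra! h
    obtain ⟨⟨y, hy, hxy⟩, w, hw, hwx⟩ := h
    have hconn : A.OrdConnected := isPreconnected_connectedComponentIn.ordConnected
    exact (hsub (hconn.out hw hy ⟨hwx.le, hxy.le⟩)).2 hxν
  rcases hside with h | h
  · refine ⟨1 - x, 0, fun y hy => ?_⟩
    rw [primitive_greenVec hx (hsub hy).1, min_eq_left (h y hy)]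
    ring
  · refine ⟨-x, x, fun y hy => ?_⟩
    rw [primitive_greenVec hx (hsub hy).1, min_eq_right (h y hy)]
    ring

theorem primitive_orthogonalProjection {ν : Measure ℝ} {x : ℝ} (hx : x ∈ ν.support) {u : L2Unit}
    (hu : primitive u 1 = 0) :
    primitive ((gradientSpace ν).orthogonalProjectionOnto u : L2Unit) x = primitive u x := by
  set v := (gradientSpace ν).orthogonalProjectionOnto u
  by_cases hx01 : x ∈ Set.Ioo (0 : ℝ) 1
  · have hgreen : ∀ w : L2Unit, primitive w 1 = 0 → primitive w x = ⟪greenVec x, w⟫_ℝ :=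
      fun w hw => by
        rw [greenVec, inner_sub_left, real_inner_smul_left, ← primitive_apply, ← primitive_apply,
          hw, mul_zero, sub_zero]
    rw [hgreen u hu, hgreen v v.2.1]
    exact Submodule.inner_orthogonalProjectionOnto_eq_of_mem_left
      (⟨_, greenVec_mem_gradientSpace (Set.Ioo_subset_Icc_self hx01) hx⟩ : gradientSpace ν) u
  · rw [primitive_of_notMem_Ioo hu hx01, primitive_of_notMem_Ioo v.2.1 hx01]

end GradientSpace

section FormOperator

/-- The operator on the gradient space whose form is `(∇f, ∇g) ↦ ∫ f g dν`. Its positive eigenvalues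
are the reciprocals of the eigenvalues of `ℰ_ν`. -/
def formOperator (ν : Measure ℝ) : gradientSpace ν →L[ℝ] gradientSpace ν :=
  kernelOperator ν fun y => (gradientSpace ν).orthogonalProjectionOnto (evalVec y)

variable {ν : Measure ℝ} [IsFiniteMeasure ν]

theorem memLp_orthogonalProjection_evalVec :
    MemLp (fun y => (gradientSpace ν).orthogonalProjectionOnto (evalVec y)) 2 ν :=
  ContinuousLinearMap.comp_memLp' _ <| MemLp.of_bound continuous_evalVec.aestronglyMeasurable 1 <|
    Eventually.of_forall norm_evalVec_le

theorem inner_formOperator (u v : gradientSpace ν) :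
    ⟪formOperator ν u, v⟫_ℝ =
      ∫ y, primitive (u : L2Unit) y * primitive (v : L2Unit) y ∂ν := by
  rw [formOperator, inner_kernelOperator memLp_orthogonalProjection_evalVec]
  simp only [Submodule.inner_orthogonalProjectionOnto_eq_of_mem_right, primitive_apply]

theorem isEigenfunction_primitive {u : gradientSpace ν} (hu0 : u ≠ 0) {r : ℝ} (hr : r ≠ 0)
    (hu : formOperator ν u = r • u) : IsEigenfunction ν r⁻¹ (primitive u) := by
  refine ⟨mem_formDomain_iff.2 ⟨u, u.2, rfl⟩, fun h => hu0 (Subtype.ext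
    (primitive_injective (h.trans (map_zero primitive).symm))), fun g hg => ?_⟩
  obtain ⟨v, hv, rfl⟩ := mem_formDomain_iff.1 hg
  have hform : r * ⟪(u : L2Unit), v⟫_ℝ = ∫ y, primitive u y * primitive v y ∂ν := by
    rw [← inner_formOperator u ⟨v, hv⟩, hu]
    exact (real_inner_smul_left _ _ _).symm
  rw [energy_primitive, ← hform, inv_mul_cancel_left₀ hr]

theorem rank_topEigenspan_le_eigenvalueCount {x : ℝ} (hx : 0 < x) :
    Cardinal.toENat (Module.rank ℝ (topEigenspan (formOperator ν) x⁻¹)) ≤ eigenvalueCount ν x := by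
  let Φ : gradientSpace ν →ₗ[ℝ] (ℝ → ℝ) := primitive ∘ₗ (gradientSpace ν).subtype
  have hΦ : Function.Injective Φ := primitive_injective.comp (gradientSpace ν).subtype_injective
  have hmap : (topEigenspan (formOperator ν) x⁻¹).map Φ ≤
      Submodule.span ℝ {f : ℝ → ℝ | ∃ μ ≤ x, IsEigenfunction ν μ f} := by
    rw [topEigenspan, Submodule.map_span, Submodule.span_le]
    rintro _ ⟨u, ⟨r, hr, hu⟩, rfl⟩
    rcases eq_or_ne u 0 with rfl | hu0
    · rw [map_zero]
      exact Submodule.zero_mem _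
    · have hr0 : 0 < r := (inv_pos.2 hx).trans_le hr
      exact Submodule.subset_span
        ⟨r⁻¹, inv_le_of_inv_le₀ hx hr, isEigenfunction_primitive hu0 hr0.ne' hu⟩
  refine Cardinal.toENat.monotone' ?_
  have hrank := (Submodule.equivMapOfInjective Φ hΦ
    (topEigenspan (formOperator ν) x⁻¹)).lift_rank_eq
  exact (Cardinal.lift_inj.1 hrank).le.trans (Submodule.rank_mono hmap)

/-- The lower half of the min-max principle for `ℰ_ν`. The trial functions need not be affine off
the support of `ν`: projecting onto the gradient space only decreases the energy. -/
theorem finrank_le_eigenvalueCount {x : ℝ} (hx : 0 < x) {E : Type*} [AddCommGroup E] [Module ℝ E]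
    (L : E →ₗ[ℝ] L2Unit) (hL1 : ∀ c, primitive (L c) 1 = 0)
    (hL : ∀ c ≠ 0, ‖L c‖ ^ 2 < x * ∫ y, primitive (L c) y ^ 2 ∂ν) :
    (Module.finrank ℝ E : ℕ∞) ≤ eigenvalueCount ν x := by
  refine le_trans ?_ (rank_topEigenspan_le_eigenvalueCount hx)
  let P := (gradientSpace ν).orthogonalProjectionOnto
  refine finrank_le_rank_topEigenspan (isPositive_kernelOperator memLp_orthogonalProjection_evalVec)
    (isCompactOperator_kernelOperator _ _) (inv_pos.2 hx).le
    ((P : L2Unit →ₗ[ℝ] gradientSpace ν) ∘ₗ L) fun c hc => ?_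
  have hform : ⟪formOperator ν (P (L c)), P (L c)⟫_ℝ = ∫ y, primitive (L c) y ^ 2 ∂ν := by
    rw [inner_formOperator]
    refine integral_congr_ae (Eventually.mono Measure.support_mem_ae fun y hy => ?_)
    simp only [P, primitive_orthogonalProjection hy (hL1 c), sq]
  calc x⁻¹ * ‖P (L c)‖ ^ 2 ≤ x⁻¹ * ‖L c‖ ^ 2 := by
        gcongr
        exact (gradientSpace ν).norm_orthogonalProjectionOnto_apply_le _
    _ < ∫ y, primitive (L c) y ^ 2 ∂ν := (inv_mul_lt_iff₀ hx).2 (hL c hc)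
    _ = ⟪formOperator ν (P (L c)), P (L c)⟫_ℝ := hform.symm

end FormOperator

section TrialFunctions

theorem norm_sum_smul_sq_of_pairwise_orthogonal {H ι : Type*} [NormedAddCommGroup H]
    [InnerProductSpace ℝ H] [Fintype ι] {w : ι → H} (hw : Pairwise fun i j => ⟪w i, w j⟫_ℝ = 0)
    (c : ι → ℝ) : ‖∑ i, c i • w i‖ ^ 2 = ∑ i, c i ^ 2 * ‖w i‖ ^ 2 := by
  rw [← real_inner_self_eq_norm_sq, sum_inner]
  refine Finset.sum_congr rfl fun i _ => ?_
  rw [inner_sum, Finset.sum_eq_single_of_mem i (Finset.mem_univ i) fun j _ hji => by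
    rw [real_inner_smul_left, real_inner_smul_right, hw hji.symm, mul_zero, mul_zero]]
  rw [real_inner_smul_left, real_inner_smul_right, real_inner_self_eq_norm_sq]
  ring

theorem mul_sum_sq_le_integral_sq {α ι : Type*} [MeasurableSpace α] {μ : Measure α} [Fintype ι]
    {f : α → ℝ} (hf : Integrable (fun y => f y ^ 2) μ) {S : ι → Set α}
    (hS : ∀ i, MeasurableSet (S i)) (hdisj : Pairwise (Function.onFun Disjoint S)) {c : ι → ℝ}
    (hfc : ∀ i, ∀ y ∈ S i, f y = c i) {m : ℝ} (hm : ∀ i, m ≤ μ.real (S i)) :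
    m * ∑ i, c i ^ 2 ≤ ∫ y, f y ^ 2 ∂μ :=
  calc m * ∑ i, c i ^ 2 = ∑ i, m * c i ^ 2 := Finset.mul_sum _ _ _
    _ ≤ ∑ i, μ.real (S i) * c i ^ 2 :=
        Finset.sum_le_sum fun i _ => mul_le_mul_of_nonneg_right (hm i) (sq_nonneg _)
    _ = ∑ i, ∫ y in S i, f y ^ 2 ∂μ := Finset.sum_congr rfl fun i _ => by
        rw [setIntegral_congr_fun (g := fun _ => c i ^ 2) (hS i) fun y hy => by rw [hfc i y hy],
          setIntegral_const, smul_eq_mul]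
    _ = ∫ y in ⋃ i, S i, f y ^ 2 ∂μ :=
        (integral_iUnion_fintype hS hdisj fun _ => hf.integrableOn).symm
    _ ≤ ∫ y, f y ^ 2 ∂μ := setIntegral_le_integral hf (Eventually.of_forall fun _ => sq_nonneg _)

variable {ν : Measure ℝ} [IsFiniteMeasure ν]

theorem integrable_primitive_sq (u : L2Unit) : Integrable (fun y => primitive u y ^ 2) ν := by
  refine Integrable.of_bound ((continuous_primitive u).pow 2).aestronglyMeasurable (‖u‖ ^ 2)
    (Eventually.of_forall fun y => ?_)
  rw [norm_pow]
  gcongr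
  calc ‖primitive u y‖ ≤ ‖evalVec y‖ * ‖u‖ := abs_real_inner_le_norm (evalVec y) u
    _ ≤ ‖u‖ := mul_le_of_le_one_left (norm_nonneg u) (norm_evalVec_le y)

theorem card_le_eigenvalueCount_of_pairwise_orthogonal {ι : Type*} [Fintype ι] {w : ι → L2Unit}
    {S : ι → Set ℝ} {K m x : ℝ} (hw1 : ∀ i, primitive (w i) 1 = 0)
    (horth : Pairwise fun i j => ⟪w i, w j⟫_ℝ = 0) (hK : ∀ i, ‖w i‖ ^ 2 ≤ K)
    (hS : ∀ i, MeasurableSet (S i)) (hone : ∀ i, ∀ y ∈ S i, primitive (w i) y = 1)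
    (hzero : ∀ i j, i ≠ j → ∀ y ∈ S i, primitive (w j) y = 0) (hm : ∀ i, m ≤ ν.real (S i))
    (hx : 0 < x) (hKm : K < x * m) : (Fintype.card ι : ℕ∞) ≤ eigenvalueCount ν x := by
  classical
  rw [← Module.finrank_fintype_fun_eq_card ℝ]
  have hprim : ∀ (c : ι → ℝ) y, primitive (Fintype.linearCombination ℝ w c) y =
      ∑ i, c i * primitive (w i) y := fun c y => by
    simp only [Fintype.linearCombination_apply, map_sum, map_smul, Finset.sum_apply, Pi.smul_apply,
      smul_eq_mul]
  have hdisj : Pairwise (Function.onFun Disjoint S) := fun i j hij =>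
    Set.disjoint_left.2 fun y hi hj => zero_ne_one ((hzero i j hij y hi).symm.trans (hone j y hj))
  refine finrank_le_eigenvalueCount hx (Fintype.linearCombination ℝ w)
    (fun c => by simp only [hprim, hw1, mul_zero, Finset.sum_const_zero]) fun c hc => ?_
  have hval : ∀ i, ∀ y ∈ S i, primitive (Fintype.linearCombination ℝ w c) y = c i :=
    fun i y hy => by
      rw [hprim, Finset.sum_eq_single_of_mem i (Finset.mem_univ i) fun j _ hji => by
        rw [hzero i j hji.symm y hy, mul_zero], hone i y hy, mul_one]
  have hpos : 0 < ∑ i, c i ^ 2 := by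
    obtain ⟨i, hi⟩ := Function.ne_iff.1 hc
    exact Finset.sum_pos' (fun _ _ => sq_nonneg _) ⟨i, Finset.mem_univ _, sq_pos_of_ne_zero hi⟩
  calc ‖Fintype.linearCombination ℝ w c‖ ^ 2 = ∑ i, c i ^ 2 * ‖w i‖ ^ 2 :=
        norm_sum_smul_sq_of_pairwise_orthogonal horth c
    _ ≤ ∑ i, c i ^ 2 * K := by gcongr with i; exact hK i
    _ = K * ∑ i, c i ^ 2 := by rw [← Finset.sum_mul, mul_comm]
    _ < x * m * ∑ i, c i ^ 2 := by gcongr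
    _ = x * (m * ∑ i, c i ^ 2) := mul_assoc _ _ _
    _ ≤ x * ∫ y, primitive (Fintype.linearCombination ℝ w c) y ^ 2 ∂ν := by
        gcongr
        exact mul_sum_sq_le_integral_sq (integrable_primitive_sq _) hS hdisj hval hm

end TrialFunctions

section Trapezoid

/-- The gradient of the trapezoid which is supported on `[c - h, c + 2h]`, affine on
`[c - h, c]` and `[c + h, c + 2h]`, and equal to `1` on `[c, c + h]`. -/
def trapezoid (c h : ℝ) : L2Unit :=
  h⁻¹ • (evalVec c - evalVec (c - h) - evalVec (c + 2 * h) + evalVec (c + h))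

variable {c h : ℝ}

theorem primitive_trapezoid (hh : 0 < h) (hc : h ≤ c) (hc1 : c + 2 * h ≤ 1) {y : ℝ}
    (hy : y ∈ Set.Icc (0 : ℝ) 1) : primitive (trapezoid c h) y =
      h⁻¹ * (min y c - min y (c - h) - min y (c + 2 * h) + min y (c + h)) := by
  have hmem : ∀ x, c - h ≤ x → x ≤ c + 2 * h → primitive (evalVec x) y = min y x :=
    fun x h1 h2 => primitive_evalVec_of_mem ⟨(sub_nonneg.2 hc).trans h1, h2.trans hc1⟩ hy
  simp only [trapezoid, map_smul, map_add, map_sub, Pi.smul_apply, Pi.add_apply, Pi.sub_apply,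
    smul_eq_mul]
  rw [hmem c (by linarith) (by linarith), hmem (c - h) le_rfl (by linarith),
    hmem (c + 2 * h) (by linarith) le_rfl, hmem (c + h) (by linarith) (by linarith)]

theorem primitive_trapezoid_of_mem (hh : 0 < h) (hc : h ≤ c) (hc1 : c + 2 * h ≤ 1) {y : ℝ}
    (hy : y ∈ Set.Icc c (c + h)) : primitive (trapezoid c h) y = 1 := by
  obtain ⟨hy1, hy2⟩ := hy
  rw [primitive_trapezoid hh hc hc1 ⟨by linarith, by linarith⟩, min_eq_right hy1,
    min_eq_right (by linarith), min_eq_left (by linarith), min_eq_left hy2]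
  field_simp
  ring

theorem primitive_trapezoid_of_le (hh : 0 < h) (hc : h ≤ c) (hc1 : c + 2 * h ≤ 1) {y : ℝ}
    (hy0 : 0 ≤ y) (hy : y ≤ c - h) : primitive (trapezoid c h) y = 0 := by
  rw [primitive_trapezoid hh hc hc1 ⟨hy0, by linarith⟩, min_eq_left (by linarith),
    min_eq_left hy, min_eq_left (by linarith), min_eq_left (by linarith)]
  ring

theorem primitive_trapezoid_of_ge (hh : 0 < h) (hc : h ≤ c) (hc1 : c + 2 * h ≤ 1) {y : ℝ}
    (hy : c + 2 * h ≤ y) (hy1 : y ≤ 1) : primitive (trapezoid c h) y = 0 := by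
  rw [primitive_trapezoid hh hc hc1 ⟨by linarith, hy1⟩, min_eq_right (by linarith),
    min_eq_right (by linarith), min_eq_right hy, min_eq_right (by linarith)]
  ring

theorem inner_trapezoid_left (u : L2Unit) : ⟪trapezoid c h, u⟫_ℝ = h⁻¹ *
    (primitive u c - primitive u (c - h) - primitive u (c + 2 * h) + primitive u (c + h)) := by
  simp only [trapezoid, real_inner_smul_left, inner_add_left, inner_sub_left, primitive_apply]

theorem norm_trapezoid_sq (hh : 0 < h) (hc : h ≤ c) (hc1 : c + 2 * h ≤ 1) :
    ‖trapezoid c h‖ ^ 2 = 2 / h := by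
  rw [← real_inner_self_eq_norm_sq, inner_trapezoid_left,
    primitive_trapezoid_of_mem hh hc hc1 ⟨le_rfl, by linarith⟩,
    primitive_trapezoid_of_mem hh hc hc1 ⟨by linarith, le_rfl⟩,
    primitive_trapezoid_of_le hh hc hc1 (by linarith) le_rfl,
    primitive_trapezoid_of_ge hh hc hc1 le_rfl hc1]
  ring

theorem inner_trapezoid_of_add_le {c' : ℝ} (hh : 0 < h) (hc : h ≤ c) (hc' : c' + 2 * h ≤ 1)
    (hcc' : c + 3 * h ≤ c') : ⟪trapezoid c h, trapezoid c' h⟫_ℝ = 0 := by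
  have hzero : ∀ y, 0 ≤ y → y ≤ c' - h → primitive (trapezoid c' h) y = 0 := fun y hy0 hy =>
    primitive_trapezoid_of_le hh (by linarith) hc' hy0 hy
  rw [inner_trapezoid_left, hzero c (by linarith) (by linarith),
    hzero (c - h) (by linarith) (by linarith), hzero (c + 2 * h) (by linarith) (by linarith),
    hzero (c + h) (by linarith) (by linarith)]
  ring

theorem inner_trapezoid_of_le_abs_sub {c' : ℝ} (hh : 0 < h) (hc : h ≤ c) (hc1 : c + 2 * h ≤ 1)
    (hc' : h ≤ c') (hc1' : c' + 2 * h ≤ 1) (hcc' : 3 * h ≤ |c - c'|) :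
    ⟪trapezoid c h, trapezoid c' h⟫_ℝ = 0 := by
  rcases le_abs'.1 hcc' with hlt | hgt
  · exact inner_trapezoid_of_add_le hh hc hc1' (by linarith)
  · rw [real_inner_comm]
    exact inner_trapezoid_of_add_le hh hc' hc1 (by linarith)

variable {ν : Measure ℝ} [IsFiniteMeasure ν]

theorem card_le_eigenvalueCount_of_separated {ι : Type*} [Fintype ι] {c : ι → ℝ} {m x : ℝ}
    (hh : 0 < h) (hc : ∀ i, h ≤ c i) (hc1 : ∀ i, c i + 2 * h ≤ 1)
    (hsep : Pairwise fun i j => 3 * h ≤ |c i - c j|)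
    (hm : ∀ i, m ≤ ν.real (Set.Ioc (c i) (c i + h))) (hx : 0 < x) (hxm : 2 / h < x * m) :
    (Fintype.card ι : ℕ∞) ≤ eigenvalueCount ν x := by
  refine card_le_eigenvalueCount_of_pairwise_orthogonal (w := fun i => trapezoid (c i) h)
    (fun i => primitive_trapezoid_of_ge hh (hc i) (hc1 i) (hc1 i) le_rfl)
    (fun i j hij => inner_trapezoid_of_le_abs_sub hh (hc i) (hc1 i) (hc j) (hc1 j) (hsep hij))
    (fun i => (norm_trapezoid_sq hh (hc i) (hc1 i)).le) (fun _ => measurableSet_Ioc)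
    (fun i y hy => primitive_trapezoid_of_mem hh (hc i) (hc1 i) (Set.Ioc_subset_Icc_self hy))
    (fun i j hij y hy => ?_) hm hx hxm
  rcases le_abs'.1 (hsep hij) with hlt | hgt
  · exact primitive_trapezoid_of_le hh (hc j) (hc1 j) (by linarith [hy.1, hc i])
      (by linarith [hy.2])
  · exact primitive_trapezoid_of_ge hh (hc j) (hc1 j) (by linarith [hy.1])
      (by linarith [hy.2, hc1 i])

end Trapezoid

section LowerSpectralDim

variable {ν : Measure ℝ} [IsFiniteMeasure ν]

theorem exists_one_le_eigenvalueCount (hν : ν (Set.Ioo (0 : ℝ) 1)ᶜ = 0) (hν0 : ν ≠ 0) :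
    ∃ x₀ : ℝ, ∀ x > x₀, 1 ≤ eigenvalueCount ν x := by
  have hhalf : (1 / 2 : ℝ) ∈ Set.Icc (0 : ℝ) 1 := by norm_num
  set u := greenVec (1 / 2)
  have hpos : ∀ y ∈ Set.Ioo (0 : ℝ) 1, 0 < primitive u y := fun y hy => by
    rw [primitive_greenVec hhalf (Set.Ioo_subset_Icc_self hy), sub_pos, lt_min_iff]
    constructor <;> linarith [hy.1, hy.2]
  have hint : 0 < ∫ y, primitive u y ^ 2 ∂ν := by
    rw [integral_pos_iff_support_of_nonneg (fun _ => sq_nonneg _) (integrable_primitive_sq u)]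
    refine pos_of_ne_zero fun h0 => hν0 ?_
    rw [← Measure.measure_univ_eq_zero, ← Set.union_compl_self (Set.Ioo (0 : ℝ) 1)]
    exact measure_union_null (measure_mono_null (fun y hy => (pow_pos (hpos y hy) 2).ne') h0) hν
  refine ⟨‖u‖ ^ 2 / ∫ y, primitive u y ^ 2 ∂ν, fun x hx => ?_⟩
  have hx0 : 0 < x := (div_nonneg (sq_nonneg _) hint.le).trans_lt hx
  have hcount := finrank_le_eigenvalueCount hx0 (LinearMap.toSpanSingleton ℝ L2Unit u)
    (fun c => by
      rw [LinearMap.toSpanSingleton_apply, map_smul, Pi.smul_apply, primitive_greenVec_one hhalf,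
        smul_zero]) fun c hc => by
      simp only [LinearMap.toSpanSingleton_apply, map_smul, Pi.smul_apply, smul_eq_mul, mul_pow,
        integral_const_mul, norm_smul, Real.norm_eq_abs, sq_abs]
      rw [mul_left_comm]
      exact mul_lt_mul_of_pos_left ((div_lt_iff₀ hint).1 hx) (sq_pos_of_ne_zero hc)
  rwa [Module.finrank_self, Nat.cast_one] at hcount

theorem lowerSpectralDim_nonneg (hν : ν (Set.Ioo (0 : ℝ) 1)ᶜ = 0) (hν0 : ν ≠ 0) :
    0 ≤ lowerSpectralDim ν := by
  obtain ⟨x₀, hx₀⟩ := exists_one_le_eigenvalueCount hν hν0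
  refine le_liminf_of_le (by isBoundedDefault) ?_
  filter_upwards [eventually_gt_atTop x₀, eventually_ge_atTop 1] with x hx hx1
  refine EReal.div_nonneg (ENNReal.zero_le_log_iff.2 ?_)
    (EReal.coe_nonneg.2 (Real.log_nonneg hx1))
  exact_mod_cast hx₀ x hx

end LowerSpectralDim

section PartitionFunction

theorem measurableSet_dyadic (n k : ℕ) : MeasurableSet (dyadic n k) := measurableSet_Ioc

theorem dyadic_eq_Ioc_succ (n k : ℕ) :
    dyadic n k = Set.Ioc ((k : ℝ) / 2 ^ n) ((Order.succ k : ℕ) / 2 ^ n) := by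
  rw [Nat.succ_eq_succ, Nat.cast_succ, dyadic]

theorem monotone_natCast_div_two_pow (n : ℕ) : Monotone fun k : ℕ => (k : ℝ) / 2 ^ n :=
  fun _ _ hjk => by dsimp only; gcongr

theorem pairwise_disjoint_dyadic (n : ℕ) : Pairwise (Function.onFun Disjoint (dyadic n)) := by
  rw [funext (dyadic_eq_Ioc_succ n)]
  exact (monotone_natCast_div_two_pow n).pairwise_disjoint_on_Ioc_succ

theorem biUnion_dyadic (n : ℕ) : ⋃ k ∈ Finset.range (2 ^ n), dyadic n k = Set.Ioc 0 1 := by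
  have h := (monotone_natCast_div_two_pow n).biUnion_Ico_Ioc_map_succ 0 (2 ^ n)
  simpa only [← dyadic_eq_Ioc_succ, Nat.cast_zero, zero_div, Nat.cast_pow, Nat.cast_ofNat,
    div_self (pow_ne_zero n (two_ne_zero (α := ℝ))), Set.mem_Ico, Nat.zero_le, true_and,
    Finset.mem_range] using h

open Classical in
/-- The indices of the dyadic intervals of generation `n` which are charged by `ν`. -/
def chargedDyadic (ν : Measure ℝ) (n : ℕ) : Finset ℕ :=
  (Finset.range (2 ^ n)).filter fun k => 0 < ν (dyadic n k)

/-- The partition function `∑_C ν(C)^q` over the charged dyadic intervals of generation `n`, whose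
exponential growth rate in `n` is `β_ν(q)`. -/
def dyadicSum (ν : Measure ℝ) (n : ℕ) (q : ℝ) : ℝ :=
  ∑ k ∈ chargedDyadic ν n, ν.real (dyadic n k) ^ q

theorem lqSpectrumAt_eq (ν : Measure ℝ) (n : ℕ) (q : ℝ) :
    lqSpectrumAt ν n q = Real.log (dyadicSum ν n q) / (n * Real.log 2) := by
  rw [← Real.log_pow, div_eq_inv_mul, ← one_div]
  rfl

variable {ν : Measure ℝ} [IsFiniteMeasure ν]

theorem measureReal_dyadic_pos {n k : ℕ} (hk : k ∈ chargedDyadic ν n) :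
    0 < ν.real (dyadic n k) := by
  classical
  exact ENNReal.toReal_pos (Finset.mem_filter.1 hk).2.ne' (measure_ne_top _ _)

theorem sum_chargedDyadic (hν : ν (Set.Ioo (0 : ℝ) 1)ᶜ = 0) (n : ℕ) :
    ∑ k ∈ chargedDyadic ν n, ν.real (dyadic n k) = ν.real Set.univ := by
  classical
  calc ∑ k ∈ chargedDyadic ν n, ν.real (dyadic n k)
      = ∑ k ∈ Finset.range (2 ^ n), ν.real (dyadic n k) :=
        Finset.sum_filter_of_ne fun k _ hk => pos_iff_ne_zero.2 fun h0 => hk (by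
          rw [measureReal_def, h0, ENNReal.toReal_zero])
    _ = ν.real (Set.Ioc 0 1) := by
        rw [← measureReal_biUnion_finset ((pairwise_disjoint_dyadic n).set_pairwise _)
          fun k _ => measurableSet_dyadic n k, biUnion_dyadic]
    _ = ν.real Set.univ := measureReal_congr (ae_eq_univ.2 (measure_mono_null
        (Set.compl_subset_compl.2 Set.Ioo_subset_Ioc_self) hν))

theorem dyadicSum_pos (hν : ν (Set.Ioo (0 : ℝ) 1)ᶜ = 0) (hν0 : ν ≠ 0) (n : ℕ) (q : ℝ) :
    0 < dyadicSum ν n q := by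
  refine Finset.sum_pos (fun k hk => Real.rpow_pos_of_pos (measureReal_dyadic_pos hk) _)
    (Finset.nonempty_of_sum_ne_zero (f := fun k => ν.real (dyadic n k)) ?_)
  have : NeZero ν := ⟨hν0⟩
  rw [sum_chargedDyadic hν n]
  exact measureReal_univ_ne_zero

theorem two_rpow_lqSpectrumAt (hν : ν (Set.Ioo (0 : ℝ) 1)ᶜ = 0) (hν0 : ν ≠ 0) {n : ℕ} (hn : n ≠ 0)
    (q : ℝ) : (2 : ℝ) ^ (n * lqSpectrumAt ν n q) = dyadicSum ν n q := by
  have hlog : Real.log 2 * (n * lqSpectrumAt ν n q) = Real.log (dyadicSum ν n q) := by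
    rw [lqSpectrumAt_eq]
    field_simp [(Real.log_pos one_lt_two).ne']
  rw [Real.rpow_def_of_pos two_pos, hlog, Real.exp_log (dyadicSum_pos hν hν0 n q)]

theorem eventually_dyadicSum_le (hν : ν (Set.Ioo (0 : ℝ) 1)ᶜ = 0) (hν0 : ν ≠ 0) {q r : ℝ}
    (hr : lqSpectrum ν q < r) : ∀ᶠ n : ℕ in atTop, dyadicSum ν n q ≤ (2 : ℝ) ^ (n * r) := by
  filter_upwards [eventually_lt_of_limsup_lt hr, eventually_ne_atTop 0] with n hn hn0
  rw [← two_rpow_lqSpectrumAt hν hν0 hn0]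
  have hle : lqSpectrumAt ν n q ≤ r := (EReal.coe_lt_coe_iff.1 hn).le
  exact Real.rpow_le_rpow_of_exponent_le one_le_two (by gcongr)

theorem eventually_le_dyadicSum (hν : ν (Set.Ioo (0 : ℝ) 1)ᶜ = 0) (hν0 : ν ≠ 0) {q r B : ℝ}
    (hlim : Tendsto (fun n => lqSpectrumAt ν n q) atTop (𝓝 B)) (hr : r < B) :
    ∀ᶠ n : ℕ in atTop, (2 : ℝ) ^ (n * r) ≤ dyadicSum ν n q := by
  filter_upwards [hlim.eventually_const_lt hr, eventually_ne_atTop 0] with n hn hn0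
  rw [← two_rpow_lqSpectrumAt hν hν0 hn0]
  exact Real.rpow_le_rpow_of_exponent_le one_le_two (by gcongr)

theorem dyadicSum_le_of_one_le (hν : ν (Set.Ioo (0 : ℝ) 1)ᶜ = 0) {q : ℝ} (hq : 1 ≤ q) (n : ℕ) :
    dyadicSum ν n q ≤ ν.real Set.univ ^ q :=
  calc dyadicSum ν n q
      ≤ ∑ k ∈ chargedDyadic ν n, ν.real (dyadic n k) * ν.real Set.univ ^ (q - 1) :=
        Finset.sum_le_sum fun k _ => by
          have : 0 ≤ q - 1 := sub_nonneg.2 hq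
          nth_rw 1 [← add_sub_cancel 1 q]
          rw [Real.rpow_one_add' measureReal_nonneg (by linarith)]
          gcongr
          exacts [measure_ne_top ν _, Set.subset_univ _]
    _ = ν.real Set.univ ^ q := by
        rw [← Finset.sum_mul, sum_chargedDyadic hν n,
          ← Real.rpow_one_add' measureReal_nonneg (by linarith), add_sub_cancel]

theorem lqSpectrum_nonpos (hν : ν (Set.Ioo (0 : ℝ) 1)ᶜ = 0) (hν0 : ν ≠ 0) {q : ℝ} (hq : 1 ≤ q) :
    lqSpectrum ν q ≤ 0 := by
  set C := Real.log (ν.real Set.univ ^ q)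
  have hle : ∀ n : ℕ, (lqSpectrumAt ν n q : EReal) ≤ ((C / (n * Real.log 2) : ℝ) : EReal) := by
    intro n
    rw [EReal.coe_le_coe_iff, lqSpectrumAt_eq]
    gcongr
    exact Real.log_le_log (dyadicSum_pos hν hν0 n q) (dyadicSum_le_of_one_le hν hq n)
  have hlim : Tendsto (fun n : ℕ => ((C / (n * Real.log 2) : ℝ) : EReal)) atTop (𝓝 0) :=
    EReal.tendsto_coe.2 (Tendsto.const_div_atTop
      (tendsto_natCast_atTop_atTop.atTop_mul_const (Real.log_pos one_lt_two)) C)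
  exact (limsup_le_limsup (Eventually.of_forall hle)).trans hlim.limsup_eq.le

end PartitionFunction

section Subdifferential

variable {ν : Measure ℝ} {q B a s : ℝ}

theorem lqSpectrum_eq_coe_of_tendsto (hlim : Tendsto (fun n => lqSpectrumAt ν n q) atTop (𝓝 B)) :
    lqSpectrum ν q = B :=
  (EReal.tendsto_coe.2 hlim).limsup_eq

theorem neg_mem_lqSubdifferential_iff (hB : lqSpectrum ν q = B) :
    -s ∈ lqSubdifferential ν q ↔ ∀ t, ((B - s * (t - q) : ℝ) : EReal) ≤ lqSpectrum ν t := by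
  refine forall_congr' fun t => ?_
  rw [hB, ← EReal.coe_add, neg_mul, neg_add_eq_sub]

/-- If `-a` is a subgradient at `q` and `-s` is not, then this is witnessed on the right of `q` for
`s < a` and on the left of `q` for `a < s`. -/
theorem exists_lqSpectrum_lt (hB : lqSpectrum ν q = B) (ha : -a ∈ lqSubdifferential ν q)
    (hs : -s ∉ lqSubdifferential ν q) :
    ∃ t, 0 < (a - s) * (t - q) ∧ lqSpectrum ν t < ((B - s * (t - q) : ℝ) : EReal) := by
  rw [neg_mem_lqSubdifferential_iff hB] at ha hs
  push Not at hs
  obtain ⟨t, ht⟩ := hs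
  have hlt := EReal.coe_lt_coe_iff.1 ((ha t).trans_lt ht)
  exact ⟨t, by linarith, ht⟩

variable [IsFiniteMeasure ν]

theorem exists_lqSpectrum_eq_coe (hν : ν (Set.Ioo (0 : ℝ) 1)ᶜ = 0) (hν0 : ν ≠ 0)
    (ha : -a ∈ lqSubdifferential ν q) (hs : -s ∉ lqSubdifferential ν q) :
    ∃ B : ℝ, lqSpectrum ν q = B := by
  refine ⟨(lqSpectrum ν q).toReal, (EReal.coe_toReal (fun htop => ?_) fun hbot => hs ?_).symm⟩
  · have h1 := (ha 1).trans (lqSpectrum_nonpos hν hν0 le_rfl)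
    rw [htop, EReal.coe_add_top] at h1
    exact EReal.zero_lt_top.not_ge h1
  · intro t
    rw [hbot, EReal.add_bot]
    exact bot_le

theorem nonneg_of_neg_mem_lqSubdifferential (hν : ν (Set.Ioo (0 : ℝ) 1)ᶜ = 0) (hν0 : ν ≠ 0)
    (hB : lqSpectrum ν q = B) (hs : -s ∈ lqSubdifferential ν q) : 0 ≤ s := by
  rw [neg_mem_lqSubdifferential_iff hB] at hs
  have hline : ∀ t ≥ 1, B - s * (t - q) ≤ 0 := fun t ht =>
    EReal.coe_le_coe_iff.1 ((hs t).trans (lqSpectrum_nonpos hν hν0 ht))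
  by_contra! hneg
  have htend : Tendsto (fun t => B - s * (t - q)) atTop atTop := by
    simp only [sub_eq_add_neg B, ← neg_mul]
    exact tendsto_atTop_add_const_left _ _ (Tendsto.const_mul_atTop (neg_pos.2 hneg)
      (tendsto_atTop_add_const_right _ _ tendsto_id))
  obtain ⟨t, ht1, htpos⟩ := ((eventually_ge_atTop 1).and (htend.eventually_gt_atTop 0)).exists
  exact htpos.not_ge (hline t ht1)

end Subdifferential

section HeavyDyadic

theorem two_rpow_natCast_mul (n : ℕ) (e : ℝ) : (2 : ℝ) ^ (n * e) = ((2 : ℝ) ^ e) ^ n := by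
  rw [mul_comm, Real.rpow_mul_natCast two_pos.le]

theorem isLittleO_two_rpow {e e' : ℝ} (h : e < e') :
    (fun n : ℕ => (2 : ℝ) ^ (n * e)) =o[atTop] fun n : ℕ => (2 : ℝ) ^ (n * e') := by
  simp only [two_rpow_natCast_mul]
  exact isLittleO_pow_pow_of_lt_left (by positivity)
    (Real.rpow_lt_rpow_of_exponent_lt one_lt_two h)

theorem eventually_mul_two_rpow_le (C : ℝ) {e e' : ℝ} (h : e < e') :
    ∀ᶠ n : ℕ in atTop, C * (2 : ℝ) ^ (n * e) ≤ (2 : ℝ) ^ (n * e') := by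
  filter_upwards [((isLittleO_two_rpow h).const_mul_left C).bound one_pos] with n hn
  rw [one_mul, Real.norm_of_nonneg (by positivity : (0 : ℝ) ≤ 2 ^ (n * e'))] at hn
  exact (le_abs_self _).trans hn

theorem sum_rpow_le_sum_large_add_sum_small_add_card_mul {ι : Type*} (C : Finset ι) {p : ι → ℝ}
    (hp : ∀ k ∈ C, 0 ≤ p k) {q u : ℝ} (hq : 0 ≤ q) (hu : 0 ≤ u) (v : ℝ) :
    ∑ k ∈ C, p k ^ q ≤
      ∑ k ∈ C with u ≤ p k, p k ^ q + ∑ k ∈ C with p k ≤ v, p k ^ q +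
        (C.filter fun k => v ≤ p k).card * u ^ q := by
  rw [Finset.sum_filter, Finset.sum_filter, Finset.natCast_card_filter, Finset.sum_mul,
    ← Finset.sum_add_distrib, ← Finset.sum_add_distrib]
  refine Finset.sum_le_sum fun k hk => ?_
  have hpq : 0 ≤ p k ^ q := Real.rpow_nonneg (hp k hk) q
  have huq : 0 ≤ u ^ q := Real.rpow_nonneg hu q
  rcases le_total u (p k) with hlarge | hnot_large
  · rw [if_pos hlarge, add_assoc]
    exact le_add_of_nonneg_right (add_nonneg (by split_ifs <;> simp [hpq])
      (mul_nonneg (by split_ifs <;> simp) huq))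
  rcases le_total (p k) v with hsmall | hheavy
  · rw [if_pos hsmall, add_right_comm]
    exact le_add_of_nonneg_left (add_nonneg (by split_ifs <;> simp [hpq])
      (mul_nonneg (by split_ifs <;> simp) huq))
  · rw [if_pos hheavy, one_mul]
    exact (Real.rpow_le_rpow (hp k hk) hnot_large hq).trans
      (le_add_of_nonneg_left (add_nonneg (by split_ifs <;> simp [hpq])
        (by split_ifs <;> simp [hpq])))

variable {ν : Measure ℝ} [IsFiniteMeasure ν] {q B a s : ℝ}

theorem sum_rpow_le_dyadicSum_mul {n : ℕ} {t u : ℝ} {A : Finset ℕ} (hA : A ⊆ chargedDyadic ν n)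
    (hAu : ∀ k ∈ A, ν.real (dyadic n k) ^ (q - t) ≤ u) (hu : 0 ≤ u) :
    ∑ k ∈ A, ν.real (dyadic n k) ^ q ≤ dyadicSum ν n t * u :=
  calc ∑ k ∈ A, ν.real (dyadic n k) ^ q ≤ ∑ k ∈ A, ν.real (dyadic n k) ^ t * u := by
        refine Finset.sum_le_sum fun k hk => ?_
        nth_rw 1 [← add_sub_cancel t q]
        rw [Real.rpow_add (measureReal_dyadic_pos (hA hk))]
        exact mul_le_mul_of_nonneg_left (hAu k hk) (Real.rpow_nonneg measureReal_nonneg t)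
    _ ≤ dyadicSum ν n t * u := by
        rw [← Finset.sum_mul]
        refine mul_le_mul_of_nonneg_right ?_ hu
        exact Finset.sum_le_sum_of_subset_of_nonneg hA fun k _ _ =>
          Real.rpow_nonneg measureReal_nonneg t

theorem isLittleO_sum_dyadicSum (hν : ν (Set.Ioo (0 : ℝ) 1)ᶜ = 0) (hν0 : ν ≠ 0)
    (hlim : Tendsto (fun n => lqSpectrumAt ν n q) atTop (𝓝 B)) {t : ℝ}
    (ht : lqSpectrum ν t < ((B - s * (t - q) : ℝ) : EReal)) {A : ℕ → Finset ℕ}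
    (hA : ∀ n, A n ⊆ chargedDyadic ν n)
    (hAs : ∀ n, ∀ k ∈ A n, ν.real (dyadic n k) ^ (q - t) ≤ ((2 : ℝ) ^ (-(n * s))) ^ (q - t)) :
    (fun n => ∑ k ∈ A n, ν.real (dyadic n k) ^ q) =o[atTop] fun n => dyadicSum ν n q := by
  obtain ⟨r, hr, hrB⟩ := EReal.lt_iff_exists_real_btwn.1 ht
  obtain ⟨e, hre, heB⟩ := exists_between (lt_sub_iff_add_lt.1 (EReal.coe_lt_coe_iff.1 hrB))
  have hupper : ∀ᶠ n : ℕ in atTop,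
      ∑ k ∈ A n, ν.real (dyadic n k) ^ q ≤ (2 : ℝ) ^ (n * (r + s * (t - q))) := by
    filter_upwards [eventually_dyadicSum_le hν hν0 hr] with n hn
    calc ∑ k ∈ A n, ν.real (dyadic n k) ^ q
        ≤ dyadicSum ν n t * ((2 : ℝ) ^ (-(n * s))) ^ (q - t) :=
          sum_rpow_le_dyadicSum_mul (hA n) (hAs n) (by positivity)
      _ ≤ (2 : ℝ) ^ (n * r) * ((2 : ℝ) ^ (-(n * s))) ^ (q - t) := by gcongr
      _ = (2 : ℝ) ^ (n * (r + s * (t - q))) := by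
          rw [← Real.rpow_mul two_pos.le, ← Real.rpow_add two_pos]
          ring_nf
  have hsum : (fun n => ∑ k ∈ A n, ν.real (dyadic n k) ^ q) =O[atTop]
      fun n : ℕ => (2 : ℝ) ^ (n * (r + s * (t - q))) :=
    .of_norm_eventuallyLE <| hupper.mono fun n hn => (Real.norm_of_nonneg <|
      Finset.sum_nonneg fun k _ => Real.rpow_nonneg measureReal_nonneg q).trans_le hn
  have hdyadicSum : (fun n : ℕ => (2 : ℝ) ^ (n * e)) =O[atTop] fun n => dyadicSum ν n q :=
    .of_norm_eventuallyLE <| (eventually_le_dyadicSum hν hν0 hlim heB).mono fun n hn =>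
      (Real.norm_of_nonneg (by positivity)).trans_le hn
  exact hsum.trans_isLittleO ((isLittleO_two_rpow hre).trans_isBigO hdyadicSum)

theorem isLittleO_sum_large (hν : ν (Set.Ioo (0 : ℝ) 1)ᶜ = 0) (hν0 : ν ≠ 0)
    (hlim : Tendsto (fun n => lqSpectrumAt ν n q) atTop (𝓝 B))
    (ha : -a ∈ lqSubdifferential ν q) (hsa : s < a) (hs : -s ∉ lqSubdifferential ν q) :
    (fun n : ℕ => ∑ k ∈ chargedDyadic ν n with (2 : ℝ) ^ (-(n * s)) ≤ ν.real (dyadic n k),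
      ν.real (dyadic n k) ^ q) =o[atTop] fun n => dyadicSum ν n q := by
  obtain ⟨t, hpos, ht⟩ := exists_lqSpectrum_lt (lqSpectrum_eq_coe_of_tendsto hlim) ha hs
  have hqt : 0 < t - q := pos_of_mul_pos_right hpos (sub_pos.2 hsa).le
  exact isLittleO_sum_dyadicSum hν hν0 hlim ht (fun n => Finset.filter_subset _ _) fun n k hk =>
    Real.rpow_le_rpow_of_nonpos (by positivity) (Finset.mem_filter.1 hk).2 (by linarith)

theorem isLittleO_sum_small (hν : ν (Set.Ioo (0 : ℝ) 1)ᶜ = 0) (hν0 : ν ≠ 0)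
    (hlim : Tendsto (fun n => lqSpectrumAt ν n q) atTop (𝓝 B))
    (ha : -a ∈ lqSubdifferential ν q) (has : a < s) (hs : -s ∉ lqSubdifferential ν q) :
    (fun n : ℕ => ∑ k ∈ chargedDyadic ν n with ν.real (dyadic n k) ≤ (2 : ℝ) ^ (-(n * s)),
      ν.real (dyadic n k) ^ q) =o[atTop] fun n => dyadicSum ν n q := by
  obtain ⟨t, hpos, ht⟩ := exists_lqSpectrum_lt (lqSpectrum_eq_coe_of_tendsto hlim) ha hs
  have htq : t - q < 0 := neg_of_mul_pos_right hpos (sub_neg.2 has).le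
  exact isLittleO_sum_dyadicSum hν hν0 hlim ht (fun n => Finset.filter_subset _ _) fun n k hk =>
    Real.rpow_le_rpow measureReal_nonneg (Finset.mem_filter.1 hk).2 (by linarith)

theorem eventually_two_rpow_le_card (hν : ν (Set.Ioo (0 : ℝ) 1)ᶜ = 0) (hν0 : ν ≠ 0)
    (hq : 0 ≤ q) (hlim : Tendsto (fun n => lqSpectrumAt ν n q) atTop (𝓝 B)) {b c D : ℝ}
    (ha : -a ∈ lqSubdifferential ν q) (hsa : s < a) (hs : -s ∉ lqSubdifferential ν q)
    (hb : -b ∈ lqSubdifferential ν q) (hbc : b < c) (hc : -c ∉ lqSubdifferential ν q)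
    (hD : D < s * q + B) :
    ∀ᶠ n : ℕ in atTop, (2 : ℝ) ^ (n * D) ≤
      ((chargedDyadic ν n).filter fun k => (2 : ℝ) ^ (-(n * c)) ≤ ν.real (dyadic n k)).card := by
  obtain ⟨r, hDr, hrB⟩ := exists_between (sub_lt_iff_lt_add'.2 hD)
  have hthird : (0 : ℝ) < 1 / 3 := by norm_num
  filter_upwards [(isLittleO_sum_large hν hν0 hlim ha hsa hs).bound hthird,
    (isLittleO_sum_small hν hν0 hlim hb hbc hc).bound hthird,
    eventually_le_dyadicSum hν hν0 hlim hrB,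
    eventually_mul_two_rpow_le 3 (sub_lt_iff_lt_add'.1 hDr)] with n hlarge hsmall hsum hgrow
  set N := ((chargedDyadic ν n).filter fun k => (2 : ℝ) ^ (-(n * c)) ≤ ν.real (dyadic n k)).card
  have hsplit := sum_rpow_le_sum_large_add_sum_small_add_card_mul (chargedDyadic ν n)
    (p := fun k => ν.real (dyadic n k)) (fun _ _ => measureReal_nonneg) hq
    (u := (2 : ℝ) ^ (-(n * s))) (by positivity) ((2 : ℝ) ^ (-(n * c)))
  rw [Real.norm_of_nonneg (dyadicSum_pos hν hν0 n q).le] at hlarge hsmall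
  have hheavy : 1 / 3 * dyadicSum ν n q ≤ N * ((2 : ℝ) ^ (-(n * s))) ^ q := by
    have hsplit' : dyadicSum ν n q ≤ _ := hsplit
    linarith [(Real.le_norm_self _).trans hlarge, (Real.le_norm_self _).trans hsmall]
  have hpow : (2 : ℝ) ^ (n * r) * 2 ^ (n * (s * q)) = 2 ^ (n * (s * q + r)) := by
    rw [← Real.rpow_add two_pos]
    ring_nf
  have hinv : ((2 : ℝ) ^ (-(n * s))) ^ q * 2 ^ (n * (s * q)) = 1 := by
    rw [← Real.rpow_mul two_pos.le, ← Real.rpow_add two_pos]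
    ring_nf
    exact Real.rpow_zero 2
  calc (2 : ℝ) ^ (n * D) ≤ 1 / 3 * (2 ^ (n * r) * 2 ^ (n * (s * q))) := by rw [hpow]; linarith
    _ ≤ 1 / 3 * dyadicSum ν n q * 2 ^ (n * (s * q)) := by rw [← mul_assoc]; gcongr
    _ ≤ N * ((2 : ℝ) ^ (-(n * s))) ^ q * 2 ^ (n * (s * q)) := by gcongr
    _ = N := by rw [mul_assoc, hinv, mul_one]

end HeavyDyadic

section Counting

theorem exists_separated_subset {N : ℕ} {G : Finset ℕ} (hG : G ⊆ Finset.range N) :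
    ∃ T ⊆ G, (∀ k ∈ T, 1 ≤ k ∧ k + 2 ≤ N) ∧
      (∀ j ∈ T, ∀ k ∈ T, j ≠ k → 3 ≤ |(j : ℤ) - k|) ∧ G.card ≤ 3 * T.card + 4 := by
  set I := G.filter fun k => 1 ≤ k ∧ k + 2 ≤ N
  have hI : G.card ≤ I.card + 2 := by
    have hsub : G ⊆ I ∪ {0, N - 1} := by
      intro k hk
      have hkN := Finset.mem_range.1 (hG hk)
      simp only [I, Finset.mem_union, Finset.mem_filter, hk, true_and, Finset.mem_insert,
        Finset.mem_singleton]
      omega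
    calc G.card ≤ (I ∪ {0, N - 1}).card := Finset.card_le_card hsub
      _ ≤ I.card + ({0, N - 1} : Finset ℕ).card := Finset.card_union_le _ _
      _ ≤ I.card + 2 := Nat.add_le_add_left Finset.card_le_two _
  obtain ⟨i, -, hi⟩ := Finset.exists_le_card_fiber_of_mul_le_card_of_maps_to
    (s := I) (t := Finset.range 3) (f := (· % 3)) (n := I.card / 3)
    (fun k _ => Finset.mem_range.2 (Nat.mod_lt k three_pos)) ⟨0, Finset.mem_range.2 three_pos⟩
    (by rw [Finset.card_range]; exact Nat.mul_div_le _ _)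
  refine ⟨I.filter fun k => k % 3 = i,
    (Finset.filter_subset _ _).trans (Finset.filter_subset _ _),
    fun k hk => (Finset.mem_filter.1 (Finset.mem_filter.1 hk).1).2, fun j hj k hk hjk => ?_,
    by omega⟩
  have hj' := (Finset.mem_filter.1 hj).2
  have hk' := (Finset.mem_filter.1 hk).2
  rw [le_abs]
  omega

variable {ν : Measure ℝ} [IsFiniteMeasure ν]

theorem card_le_eigenvalueCount_of_dyadic {n : ℕ} {T : Finset ℕ} {m x : ℝ}
    (hT : ∀ k ∈ T, 1 ≤ k ∧ k + 2 ≤ 2 ^ n)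
    (hsep : ∀ j ∈ T, ∀ k ∈ T, j ≠ k → 3 ≤ |(j : ℤ) - k|)
    (hm : ∀ k ∈ T, m ≤ ν.real (dyadic n k)) (hx : 0 < x) (hxm : 2 * 2 ^ n < x * m) :
    (T.card : ℕ∞) ≤ eigenvalueCount ν x := by
  have hp : (0 : ℝ) < 2 ^ n := by positivity
  rw [← Fintype.card_coe]
  refine card_le_eigenvalueCount_of_separated (ι := T) (m := m) (h := 1 / 2 ^ n)
    (c := fun k => (k : ℕ) / 2 ^ n) (by positivity) (fun k => ?_) (fun k => ?_)
    (fun j k hjk => ?_) (fun k => ?_) hx (by rwa [div_div_eq_mul_div, div_one])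
  · have h1 : (1 : ℝ) ≤ (k : ℕ) := by exact_mod_cast (hT k k.2).1
    gcongr
  · have h2 : ((k : ℕ) : ℝ) + 2 ≤ 2 ^ n := by exact_mod_cast (hT k k.2).2
    rwa [mul_one_div, ← add_div, div_le_one hp]
  · have h3 : (3 : ℝ) ≤ |((j : ℕ) : ℝ) - (k : ℕ)| := by
      exact_mod_cast hsep j j.2 k k.2 (Subtype.coe_injective.ne hjk)
    change 3 * (1 / 2 ^ n) ≤ |((j : ℕ) : ℝ) / 2 ^ n - (k : ℕ) / 2 ^ n|
    rw [mul_one_div, ← sub_div, abs_div, abs_of_pos hp]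
    gcongr
  · rw [← add_div]
    exact hm k k.2

theorem eventually_two_rpow_le_eigenvalueCount {c D D' κ : ℝ}
    (hcard : ∀ᶠ n : ℕ in atTop, (2 : ℝ) ^ (n * D') ≤
      ((chargedDyadic ν n).filter fun k => (2 : ℝ) ^ (-(n * c)) ≤ ν.real (dyadic n k)).card)
    (hD' : 0 < D') (hD : D < D') (hκ : 1 + c < κ) :
    ∀ᶠ n : ℕ in atTop, ∀ x ≥ (2 : ℝ) ^ (n * κ),
      ENNReal.ofReal (2 ^ (n * D)) ≤ (eigenvalueCount ν x : ENNReal) := by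
  classical
  filter_upwards [hcard, eventually_mul_two_rpow_le 8 hD', eventually_mul_two_rpow_le 6 hD,
    eventually_mul_two_rpow_le 3 (lt_sub_iff_add_lt.2 hκ)] with n hn hlarge hgap hmass x hx
  obtain ⟨T, hTG, hT, hsep, hcardT⟩ := exists_separated_subset (N := 2 ^ n)
    ((Finset.filter_subset _ _).trans (Finset.filter_subset _ _) :
      ((chargedDyadic ν n).filter fun k => (2 : ℝ) ^ (-(n * c)) ≤ ν.real (dyadic n k)) ⊆ _)
  have hxm : 2 * 2 ^ n < x * (2 : ℝ) ^ (-(n * c)) :=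
    calc 2 * 2 ^ n < 3 * (2 : ℝ) ^ (n * 1 : ℝ) := by
          rw [mul_one, Real.rpow_natCast]
          gcongr
          norm_num
      _ ≤ (2 : ℝ) ^ (n * (κ - c)) := hmass
      _ = (2 : ℝ) ^ (n * κ) * (2 : ℝ) ^ (-(n * c)) := by
          rw [← Real.rpow_add two_pos]
          ring_nf
      _ ≤ x * (2 : ℝ) ^ (-(n * c)) := by gcongr
  have hTcount := card_le_eigenvalueCount_of_dyadic hT hsep
    (fun k hk => (Finset.mem_filter.1 (hTG hk)).2) (lt_of_lt_of_le (by positivity) hx) hxm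
  have hTcard : (2 : ℝ) ^ (n * D) ≤ T.card := by
    rw [mul_zero, Real.rpow_zero] at hlarge
    have hcardT' := hn.trans (Nat.cast_le.2 hcardT)
    push_cast at hcardT'
    linarith
  calc ENNReal.ofReal (2 ^ (n * D)) ≤ (T.card : ENNReal) := ENNReal.ofReal_le_natCast.2 hTcard
    _ = ((T.card : ℕ∞) : ENNReal) := (ENat.toENNReal_coe _).symm
    _ ≤ (eigenvalueCount ν x : ENNReal) := ENat.toENNReal_le.2 hTcount

theorem div_le_liminf_log_div_log {N : ℝ → ENNReal} {D κ : ℝ} (hκ : 0 < κ)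
    (hN : ∀ᶠ n : ℕ in atTop, ∀ x ≥ (2 : ℝ) ^ (n * κ), ENNReal.ofReal (2 ^ (n * D)) ≤ N x) :
    ((D / κ : ℝ) : EReal) ≤
      liminf (fun x : ℝ => ENNReal.log (N x) / (Real.log x : EReal)) atTop := by
  have : 0 < Real.log 2 := Real.log_pos one_lt_two
  set α := (κ * Real.log 2)⁻¹
  have hα : 0 < α := by positivity
  set n : ℝ → ℕ := fun x => ⌊α * Real.log x⌋₊
  have hlim : Tendsto (fun x => ((n x / Real.log x * (D * Real.log 2) : ℝ) : EReal)) atTop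
      (𝓝 ((D / κ : ℝ) : EReal)) := by
    have hD : α * (D * Real.log 2) = D / κ := by simp only [α]; field_simp
    rw [EReal.tendsto_coe, ← hD]
    exact ((tendsto_nat_floor_mul_div_atTop hα.le).comp Real.tendsto_log_atTop).mul_const _
  have hn : Tendsto n atTop atTop :=
    tendsto_nat_floor_atTop.comp (Real.tendsto_log_atTop.const_mul_atTop hα)
  rw [← hlim.liminf_eq]
  refine liminf_le_liminf ?_
  filter_upwards [hn.eventually hN, eventually_gt_atTop 1] with x hx hx1
  have hlogx : 0 < Real.log x := Real.log_pos hx1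
  have hfloor : n x * κ * Real.log 2 ≤ Real.log x := by
    have h : (n x : ℝ) ≤ α * Real.log x := Nat.floor_le (by positivity)
    rwa [← div_eq_inv_mul, le_div_iff₀ (by positivity), ← mul_assoc] at h
  have hxn : (2 : ℝ) ^ (n x * κ) ≤ x := by
    rwa [← Real.log_le_log_iff (by positivity) (by linarith), Real.log_rpow two_pos]
  rw [EReal.le_div_iff_mul_le (EReal.coe_pos.2 hlogx) (EReal.coe_ne_top _), ← EReal.coe_mul]
  calc ((n x / Real.log x * (D * Real.log 2) * Real.log x : ℝ) : EReal)
      = (Real.log (2 ^ (n x * D)) : ℝ) := by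
        rw [Real.log_rpow two_pos]
        field_simp
    _ = ENNReal.log (ENNReal.ofReal (2 ^ (n x * D))) :=
        (ENNReal.log_ofReal_of_pos (by positivity)).symm
    _ ≤ ENNReal.log (N x) := ENNReal.log_monotone (hx x hxn)

end Counting

section Main

variable {ν : Measure ℝ} [IsFiniteMeasure ν] {q B a b : ℝ}

theorem div_le_lowerSpectralDim (hν : ν (Set.Ioo (0 : ℝ) 1)ᶜ = 0) (hν0 : ν ≠ 0) (hq : 0 ≤ q)
    (hlim : Tendsto (fun n => lqSpectrumAt ν n q) atTop (𝓝 B)) (hab : a ≤ b)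
    (hsub : ∀ s, -s ∈ lqSubdifferential ν q ↔ a ≤ s ∧ s ≤ b) {D κ : ℝ} (hD : 0 < D)
    (hDaq : D < a * q + B) (hκ : 1 + b < κ) (hκ0 : 0 < κ) :
    ((D / κ : ℝ) : EReal) ≤ lowerSpectralDim ν := by
  obtain ⟨D', hDD', hD'⟩ := exists_between hDaq
  obtain ⟨c, hbc, hcκ⟩ := exists_between (lt_sub_iff_add_lt'.2 hκ)
  have hcont : Tendsto (fun s => s * q + B) (𝓝[<] a) (𝓝 (a * q + B)) :=
    tendsto_nhdsWithin_of_tendsto_nhds (Continuous.tendsto (by fun_prop) a)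
  obtain ⟨s, hs, hsa⟩ := ((hcont.eventually_const_lt hD').and self_mem_nhdsWithin).exists
  refine div_le_liminf_log_div_log hκ0 (eventually_two_rpow_le_eigenvalueCount
    (eventually_two_rpow_le_card hν hν0 hq hlim ((hsub a).2 ⟨le_rfl, hab⟩) hsa ?_
      ((hsub b).2 ⟨hab, le_rfl⟩) hbc ?_ hs) (hD.trans hDD') hDD' (lt_sub_iff_add_lt'.1 hcκ))
  · exact fun h => hsa.not_ge ((hsub s).1 h).1
  · exact fun h => hbc.not_ge ((hsub c).1 h).2

theorem add_div_le_lowerSpectralDim (hν : ν (Set.Ioo (0 : ℝ) 1)ᶜ = 0) (hν0 : ν ≠ 0) (hq : 0 ≤ q)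
    (hB : lqSpectrum ν q = B) (hlim : Tendsto (fun n => lqSpectrumAt ν n q) atTop (𝓝 B))
    (hab : a ≤ b) (hsub : ∀ s, -s ∈ lqSubdifferential ν q ↔ a ≤ s ∧ s ≤ b) :
    (((a * q + B) / (1 + b) : ℝ) : EReal) ≤ lowerSpectralDim ν := by
  have hb : 0 ≤ b := nonneg_of_neg_mem_lqSubdifferential hν hν0 hB ((hsub b).2 ⟨hab, le_rfl⟩)
  by_contra! hlt
  obtain ⟨r, hdim, hr⟩ := EReal.lt_iff_exists_real_btwn.1 hlt
  have hr0 : 0 < r := EReal.coe_pos.1 ((lowerSpectralDim_nonneg hν hν0).trans_lt hdim)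
  rw [EReal.coe_lt_coe_iff, lt_div_iff₀ (by positivity), ← lt_div_iff₀' hr0] at hr
  obtain ⟨κ, hbκ, hκ⟩ := exists_between hr
  have hκ0 : 0 < κ := lt_trans (by positivity) hbκ
  have hle := div_le_lowerSpectralDim hν hν0 hq hlim hab hsub (mul_pos hr0 hκ0)
    ((lt_div_iff₀' hr0).1 hκ) hbκ hκ0
  rw [mul_div_cancel_right₀ r hκ0.ne'] at hle
  exact hdim.not_ge hle

end Main

end KreinFeller

end

open KreinFeller in
theorem proposition1p5_general (ν : Measure ℝ) [IsFiniteMeasure ν]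
    (hν : ν (Set.Ioo (0 : ℝ) 1)ᶜ = 0) (hν0 : ν ≠ 0) (q : ℝ) (hq : 0 ≤ q)
    (hlim : Tendsto (fun n : ℕ => (lqSpectrumAt ν n q : EReal)) atTop (𝓝 (lqSpectrum ν q)))
    (a : ℝ) (b : EReal) (hab : (a : EReal) ≤ b)
    (hsub : -lqSubdifferential ν q = {s : ℝ | (a : EReal) ≤ s ∧ (s : EReal) ≤ b}) :
    (((a * q : ℝ) : EReal) + lqSpectrum ν q) / (1 + b) ≤ lowerSpectralDim ν := by
  have hmem : ∀ s : ℝ, -s ∈ lqSubdifferential ν q ↔ (a : EReal) ≤ s ∧ (s : EReal) ≤ b := fun s => by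
    rw [← Set.mem_neg, hsub, Set.mem_ofPred_eq]
  induction b with
  | bot => exact absurd hab (EReal.bot_lt_coe a).not_ge
  | top =>
    rw [EReal.add_top_of_ne_bot (by decide), EReal.div_top]
    exact lowerSpectralDim_nonneg hν hν0
  | coe b =>
    simp only [EReal.coe_le_coe_iff] at hab hmem
    obtain ⟨B, hB⟩ := exists_lqSpectrum_eq_coe hν hν0 ((hmem a).2 ⟨le_rfl, hab⟩)
      (fun h => (sub_one_lt a).not_ge ((hmem (a - 1)).1 h).1)
    rw [hB, EReal.tendsto_coe] at hlim
    rw [hB, ← EReal.coe_add, ← EReal.coe_one, ← EReal.coe_add, ← EReal.coe_div]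
    exact add_div_le_lowerSpectralDim hν hν0 hq hB hlim hab hmem

theorem proposition1p5 (ν : MeasureTheory.Measure ℝ) [MeasureTheory.IsFiniteMeasure ν]
    (hν : ν (Set.Ioo (0 : ℝ) 1)ᶜ = 0) (hν0 : ν ≠ 0)
    (q : ℝ) (hq : q ∈ Set.Icc (0 : ℝ) 1)
    (hlim : Tendsto (fun n : ℕ => (KreinFeller.lqSpectrumAt ν n q : EReal)) atTop
      (𝓝 (KreinFeller.lqSpectrum ν q)))
    (a : ℝ) (b : EReal) (hab : (a : EReal) ≤ b)
    (hsub : -KreinFeller.lqSubdifferential ν q = {s : ℝ | (a : EReal) ≤ s ∧ (s : EReal) ≤ b}) :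
    (((a * q : ℝ) : EReal) + KreinFeller.lqSpectrum ν q) / (1 + b)
      ≤ KreinFeller.lowerSpectralDim ν :=
  proposition1p5_general ν hν hν0 q hq.1 hlim a b hab hsub
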